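/- Let $k$ be an algebraically closed field. Paths in quivers are composed from left to right. A \emph{Brauer graph} $\Gamma$ is a finite connected graph (loops and multiple edges allowed) with a cyclic ordering of the half-edges around each vertex and a multiplicity $e(\nu)\in\mathbb Z_{>0}$ for each vertex $\nu$. The valency of a vertex is the number of half-edges at it (a loop counts twice). Call a half-edge \emph{truncated} if its vertex has valency one and multiplicity one. The quiver $Q_\Gamma$ has the edges of $\Gamma$ as vertices. Every non-truncated half-edge $h$ of an edge $E_i$ gives one arrow $\alpha_h : i\to j$, where $E_j$ is the edge of the direct successor $h^+$ of $h$ in the cyclic ordering. For a non-truncated half-edge $h$ at a vertex $\nu$, let $C_h=\alpha_h\alpha_{h^+}\alpha_{h^{++}}\cdots$ be the cycle that runs exactly once through the arrows at $\nu$, starting with $\alpha_h$. The \emph{Brauer graph algebra} is $B_\Gamma=kQ_\Gamma/I_\Gamma$, where the ideal $I_\Gamma$ is generated by 1. $C_h^{e(\nu)}-C_{h'}^{e(\nu')}$, if $h\neq h'$ are the two half-edges of one edge, attached to $\nu$ and $\nu'$, and neither is truncated; 2. $C_h^{e(\nu)}\alpha_h$, if $h$ is a non-truncated half-edge attached to $\nu$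 and the other half-edge of the same edge is truncated; 3. $\alpha_h\alpha_{g}$, if these arrows are composable and $g\neq h^+$. The graph with a single vertex and no edge, and the graph with a single edge both of whose half-edges are truncated, are excluded. A $k$-algebra $A$ is \emph{gentle} if it is finite dimensional and Morita equivalent to $kQ/I$ for a finite connected quiver $Q$ and an admissible ideal $I$ of $kQ$ such that: (S1) at most two arrows start and at most two arrows end at each vertex of $Q$; (S2) for each arrow $\alpha$ there is at most one arrow $\beta$ composable with $\alpha$ such that $\alpha\beta\notin I$, and at most one arrow $\gamma$ composable with $\alpha$ such that $\gamma\alpha\notin I$; (S3) $I$ is generated by paths of length $2$; (S4) for each arrow $\alpha$ there is at most one arrow $\delta$ such that $\alpha\delta$ is a path in $I$, and at most one arrow $\varepsilon$ such that $\varepsilon\alpha$ is a path in $I$. The \emph{trivial extension} of $A$ is the algebra $T(A)=A\oplus D(A)$, $D(A)=\operatorname{Hom}_k(A,k)$, with multiplication $(a,f)(b,g)=(ab,\,ag+fb)$. \textbf{Corollary 1.4.} Let $\Gamma$ be a Brauer graph as above (not one of the two excluded graphs) with $e(\nu)=1$ for every vertex $\nu$. Then there is a gentle $k$-algebra $A$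 such that $B_\Gamma$ and $T(A)$ are isomorphic as $k$-algebras. -/

import Mathlib

/-! ## Path algebras of finite quivers

Paths are composed from left to right: `α β` means first `α`, then `β`. -/

/-- All paths of a quiver, with their source `p.1` and their target `p.2.1`. -/
abbrev QuiverPath (Q : Type*) [Quiver Q] := Σ i j : Q, Quiver.Path i j

/-- The path algebra `kQ`: the `k`-vector space with basis the paths of `Q`. -/
def PathAlgebra (k Q : Type*) [Field k] [Quiver Q] := QuiverPath Q →₀ k

namespace PathAlgebra

noncomputable section

variable {k Q : Type*} [Field k] [Quiver Q]

instance : AddCommGroup (PathAlgebra k Q) := inferInstanceAs (AddCommGroup (QuiverPath Q →₀ k))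

instance : Module k (PathAlgebra k Q) := inferInstanceAs (Module k (QuiverPath Q →₀ k))

variable (k Q) in
/-- The paths as a basis of the path algebra. -/
def basis : Module.Basis (QuiverPath Q) k (PathAlgebra k Q) :=
  .ofRepr (LinearEquiv.refl k (QuiverPath Q →₀ k))

variable (k) in
/-- A path as an element of the path algebra. -/
def ofPath {i j : Q} (p : Quiver.Path i j) : PathAlgebra k Q := basis k Q ⟨i, j, p⟩

open Classical in
variable (k) in
/-- The product of two paths: their concatenation, or zero if they cannot be concatenated. -/
def mulPath (p q : QuiverPath Q) : PathAlgebra k Q :=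
  if h : p.2.1 = q.1 then ofPath k (p.2.2.comp (q.2.2.cast h.symm rfl)) else 0

variable (k Q) in
/-- The multiplication of the path algebra, as a bilinear map. -/
def mulBilin : PathAlgebra k Q →ₗ[k] PathAlgebra k Q →ₗ[k] PathAlgebra k Q :=
  (basis k Q).constr k fun p => (basis k Q).constr k fun q => mulPath k p q

instance : Mul (PathAlgebra k Q) := ⟨fun x y => mulBilin k Q x y⟩

instance [Fintype Q] : One (PathAlgebra k Q) := ⟨∑ i : Q, ofPath k (Quiver.Path.nil : Quiver.Path i i)⟩

theorem mul_def (x y : PathAlgebra k Q) : x * y = mulBilin k Q x y := rfl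

theorem one_def [Fintype Q] :
    (1 : PathAlgebra k Q) = ∑ i : Q, ofPath k (Quiver.Path.nil : Quiver.Path i i) := rfl

theorem induction_on {P : PathAlgebra k Q → Prop} (x : PathAlgebra k Q) (zero : P 0)
    (add : ∀ x y, P x → P y → P (x + y))
    (smul : ∀ (c : k) (i j : Q) (p : Quiver.Path i j), P (c • ofPath k p)) : P x := by
  rw [← (basis k Q).linearCombination_repr x]
  generalize (basis k Q).repr x = f
  induction f using Finsupp.induction_linear with
  | zero => simpa using zero
  | add f g hf hg => rw [map_add]; exact add _ _ hf hg
  | single p c => rw [Finsupp.linearCombination_single]; exact smul c _ _ p.2.2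

theorem mul_ofPath_aux {i j i' j' : Q} (p : Quiver.Path i j) (q : Quiver.Path i' j') :
    ofPath k p * ofPath k q = mulPath k ⟨i, j, p⟩ ⟨i', j', q⟩ := by
  simp only [mul_def, mulBilin, ofPath, Module.Basis.constr_basis]

theorem ofPath_mul_ofPath {i j l : Q} (p : Quiver.Path i j) (q : Quiver.Path j l) :
    ofPath k p * ofPath k q = ofPath k (p.comp q) := by
  simp [mul_ofPath_aux, mulPath]

theorem ofPath_mul_ofPath_of_ne {i j i' j' : Q} (p : Quiver.Path i j) (q : Quiver.Path i' j')
    (h : j ≠ i') : ofPath k p * ofPath k q = 0 := by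
  simp [mul_ofPath_aux, mulPath, h]

theorem add_mul' (x y z : PathAlgebra k Q) : (x + y) * z = x * z + y * z := by
  simp [mul_def]

theorem mul_add' (x y z : PathAlgebra k Q) : x * (y + z) = x * y + x * z := by
  simp [mul_def]

theorem smul_mul' (c : k) (x y : PathAlgebra k Q) : (c • x) * y = c • (x * y) := by
  simp [mul_def]

theorem mul_smul' (c : k) (x y : PathAlgebra k Q) : x * (c • y) = c • (x * y) := by
  simp [mul_def]

theorem zero_mul' (x : PathAlgebra k Q) : 0 * x = 0 := by simp [mul_def]

theorem mul_zero' (x : PathAlgebra k Q) : x * 0 = 0 := by simp [mul_def]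

theorem mul_assoc' (x y z : PathAlgebra k Q) : x * y * z = x * (y * z) := by
  induction x using induction_on with
  | zero => simp only [zero_mul']
  | add x x' hx hx' => simp only [add_mul', hx, hx']
  | smul a i j p =>
  induction y using induction_on with
  | zero => simp only [zero_mul', mul_zero']
  | add y y' hy hy' => simp only [add_mul', mul_add', hy, hy']
  | smul b i' j' q =>
  induction z using induction_on with
  | zero => simp only [mul_zero']
  | add z z' hz hz' => simp only [mul_add', hz, hz']
  | smul c i'' j'' r =>
  simp only [smul_mul', mul_smul']
  congr 3
  by_cases h : j = i'
  · subst h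
    by_cases h' : j' = i''
    · subst h'
      simp only [ofPath_mul_ofPath, Quiver.Path.comp_assoc]
    · simp only [ofPath_mul_ofPath, ofPath_mul_ofPath_of_ne _ _ h', mul_zero']
  · by_cases h' : j' = i''
    · subst h'
      simp only [ofPath_mul_ofPath, ofPath_mul_ofPath_of_ne _ _ h, zero_mul']
    · simp only [ofPath_mul_ofPath_of_ne _ _ h, ofPath_mul_ofPath_of_ne _ _ h', mul_zero',
        zero_mul']

theorem one_mul' [Fintype Q] (x : PathAlgebra k Q) : 1 * x = x := by
  induction x using induction_on with
  | zero => simp only [mul_zero']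
  | add x y hx hy => simp only [mul_add', hx, hy]
  | smul c i j p =>
  rw [mul_smul', one_def]
  congr 1
  rw [mul_def, map_sum, LinearMap.sum_apply, Finset.sum_eq_single i]
  · rw [← mul_def, ofPath_mul_ofPath, Quiver.Path.nil_comp]
  · intro l _ hl
    rw [← mul_def, ofPath_mul_ofPath_of_ne _ _ hl]
  · simp

theorem mul_one' [Fintype Q] (x : PathAlgebra k Q) : x * 1 = x := by
  induction x using induction_on with
  | zero => simp only [zero_mul']
  | add x y hx hy => simp only [add_mul', hx, hy]
  | smul c i j p =>
  rw [smul_mul', one_def]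
  congr 1
  rw [mul_def, map_sum, Finset.sum_eq_single j]
  · rw [← mul_def, ofPath_mul_ofPath, Quiver.Path.comp_nil]
  · intro l _ hl
    rw [← mul_def, ofPath_mul_ofPath_of_ne _ _ hl.symm]
  · simp

instance [Fintype Q] : Ring (PathAlgebra k Q) :=
  { (inferInstance : AddCommGroup (PathAlgebra k Q)),
    (inferInstance : Mul (PathAlgebra k Q)),
    (inferInstance : One (PathAlgebra k Q)) with
    left_distrib := mul_add'
    right_distrib := add_mul'
    zero_mul := zero_mul'
    mul_zero := mul_zero'
    mul_assoc := mul_assoc'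
    one_mul := one_mul'
    mul_one := mul_one' }

instance [Fintype Q] : Algebra k (PathAlgebra k Q) :=
  Algebra.ofModule smul_mul' mul_smul'

variable (k Q) in
/-- The `m`-th power of the arrow ideal: the two-sided ideal generated by the paths of
length `m`. -/
def arrowIdealPow [Fintype Q] (m : ℕ) : TwoSidedIdeal (PathAlgebra k Q) :=
  TwoSidedIdeal.span {x | ∃ (i j : Q) (p : Quiver.Path i j), p.length = m ∧ x = ofPath k p}

end

end PathAlgebra

/-- The quotient `kQ/I`. -/
abbrev BoundQuiverAlgebra (k : Type*) {Q : Type*} [Field k] [Quiver Q] [Fintype Q]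
    (I : TwoSidedIdeal (PathAlgebra k Q)) := I.ringCon.Quotient

/-! ## Gentle algebras -/

/-- `(Q, I)` is a gentle bound quiver: `Q` is a finite connected quiver, `I` is an admissible ideal
of `kQ`, and the four gentleness conditions `s1`-`s4` hold. -/
structure IsGentleBoundQuiver (k : Type*) {Q : Type*} [Field k] [Quiver Q] [Fintype Q]
    (I : TwoSidedIdeal (PathAlgebra k Q)) : Prop where
  finite_arrows : ∀ i j : Q, Finite (i ⟶ j)
  connected : (SimpleGraph.fromRel fun i j : Q => Nonempty (i ⟶ j)).Connected
  admissible : ∃ m : ℕ, 2 ≤ m ∧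
    PathAlgebra.arrowIdealPow k Q m ≤ I ∧ I ≤ PathAlgebra.arrowIdealPow k Q 2
  /-- At most two arrows start at each vertex, and at most two arrows end there. -/
  s1 : ∀ i : Q, Nat.card (Σ j : Q, (i ⟶ j)) ≤ 2 ∧ Nat.card (Σ j : Q, (j ⟶ i)) ≤ 2
  /-- For each arrow `α` there is at most one arrow `β` with `αβ ∉ I`, and at most one
  arrow `γ` with `γα ∉ I`. -/
  s2 : ∀ (i j : Q) (α : i ⟶ j),
    {β : Σ l : Q, (j ⟶ l) | PathAlgebra.ofPath k (α.toPath.comp β.2.toPath) ∉ I}.Subsingleton ∧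
    {γ : Σ l : Q, (l ⟶ i) | PathAlgebra.ofPath k (γ.2.toPath.comp α.toPath) ∉ I}.Subsingleton
  /-- `I` is generated by paths of length two. -/
  s3 : ∃ S : Set (QuiverPath Q), (∀ p ∈ S, p.2.2.length = 2) ∧
    I = TwoSidedIdeal.span ((fun p => PathAlgebra.ofPath k p.2.2) '' S)
  /-- For each arrow `α` there is at most one arrow `δ` such that `αδ` is a path in `I`, and
  at most one arrow `ε` such that `εα` is a path in `I`. -/
  s4 : ∀ (i j : Q) (α : i ⟶ j),
    {δ : Σ l : Q, (j ⟶ l) | PathAlgebra.ofPath k (α.toPath.comp δ.2.toPath) ∈ I}.Subsingleton ∧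
    {ε : Σ l : Q, (l ⟶ i) | PathAlgebra.ofPath k (ε.2.toPath.comp α.toPath) ∈ I}.Subsingleton

universe u v w

/-- A gentle `k`-algebra: finite dimensional and Morita equivalent to `kQ/I` for a gentle bound
quiver `(Q, I)`. The universe `u` is that of the (finite) quiver `Q`. -/
def IsGentle (k : Type v) [Field k] (A : Type w) [Ring A] [Algebra k A] : Prop :=
  Module.Finite k A ∧
  ∃ (Q : Type u) (_ : Quiver.{u} Q) (_ : Fintype Q) (I : TwoSidedIdeal (PathAlgebra k Q)),
    IsGentleBoundQuiver k I ∧ IsMoritaEquivalent k A (BoundQuiverAlgebra k I)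

/-! ## Trivial extensions -/

/-- The `A`-`A`-bimodule `D(A) = Hom_k(A, k)`, with `(a • f)(x) = f (x * a)` and
`(f • a)(x) = f (a * x)`. A copy of `Module.Dual k A`, as the latter may carry other actions. -/
def DualBimodule (k A : Type*) [Field k] [Ring A] [Algebra k A] := Module.Dual k A

namespace DualBimodule

noncomputable section

variable {k A : Type*} [Field k] [Ring A] [Algebra k A]

instance : AddCommGroup (DualBimodule k A) := inferInstanceAs (AddCommGroup (Module.Dual k A))

instance : Module k (DualBimodule k A) := inferInstanceAs (Module k (Module.Dual k A))

instance : SMul A (DualBimodule k A) :=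
  ⟨fun a f => LinearMap.comp (show A →ₗ[k] k from f) (LinearMap.mulRight k a)⟩

instance : SMul Aᵐᵒᵖ (DualBimodule k A) :=
  ⟨fun a f => LinearMap.comp (show A →ₗ[k] k from f) (LinearMap.mulLeft k a.unop)⟩

instance : FunLike (DualBimodule k A) A k := inferInstanceAs (FunLike (Module.Dual k A) A k)

@[ext] theorem ext {f g : DualBimodule k A} (h : ∀ x, f x = g x) : f = g := DFunLike.ext f g h

@[simp] theorem add_apply (f g : DualBimodule k A) (x : A) : (f + g) x = f x + g x := rfl

@[simp] theorem zero_apply (x : A) : (0 : DualBimodule k A) x = 0 := rfl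

@[simp] theorem ksmul_apply (c : k) (f : DualBimodule k A) (x : A) : (c • f) x = c * f x := rfl

@[simp] theorem map_add' (f : DualBimodule k A) (x y : A) : f (x + y) = f x + f y :=
  LinearMap.map_add (show A →ₗ[k] k from f) x y

@[simp] theorem map_zero' (f : DualBimodule k A) : f 0 = 0 :=
  LinearMap.map_zero (show A →ₗ[k] k from f)

@[simp] theorem map_ksmul' (f : DualBimodule k A) (c : k) (x : A) : f (c • x) = c * f x :=
  LinearMap.map_smul (show A →ₗ[k] k from f) c x

@[simp] theorem smul_apply (a : A) (f : DualBimodule k A) (x : A) : (a • f) x = f (x * a) := rfl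

@[simp] theorem op_smul_apply (a : Aᵐᵒᵖ) (f : DualBimodule k A) (x : A) :
    (a • f) x = f (a.unop * x) := rfl

instance : Module A (DualBimodule k A) where
  one_smul f := by ext; simp
  mul_smul a b f := by ext; simp [mul_assoc]
  smul_zero a := by ext; simp
  smul_add a f g := by ext; simp
  add_smul a b f := by ext; simp [mul_add]
  zero_smul f := by ext; simp

instance : Module Aᵐᵒᵖ (DualBimodule k A) where
  one_smul f := by ext; simp
  mul_smul a b f := by ext; simp [mul_assoc]
  smul_zero a := by ext; simp
  smul_add a f g := by ext; simp
  add_smul a b f := by ext; simp [add_mul]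
  zero_smul f := by ext; simp

instance : SMulCommClass A Aᵐᵒᵖ (DualBimodule k A) where
  smul_comm a b f := by ext; simp [mul_assoc]

instance : IsScalarTower k A (DualBimodule k A) where
  smul_assoc c a f := by ext; simp

instance : IsScalarTower k Aᵐᵒᵖ (DualBimodule k A) where
  smul_assoc c a f := by ext; simp

end

end DualBimodule

/-- The trivial extension `T(A) = A ⋉ D(A)`, i.e. `A ⊕ D(A)` with
`(a, f)(b, g) = (ab, ag + fb)`. -/
abbrev TrivialExtension (k A : Type*) [Field k] [Ring A] [Algebra k A] :=
  TrivSqZeroExt A (DualBimodule k A)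

/-! ## Brauer graphs and Brauer graph algebras -/

/-- A Brauer graph with vertex set `V` and edge set `E` (taken finite where it is used); loops and
multiple edges are allowed. The two half-edges of `e : E` are `(e, false)` and `(e, true)` (in an
arbitrary order). `next h` is the direct successor of the half-edge `h` in the cyclic ordering
around its vertex, so that the half-edges at each vertex form one cycle of `next`. -/
structure BrauerGraph (V : Type*) (E : Type*) where
  /-- The vertex to which a half-edge is attached. -/
  vertex : E × Bool → V
  connected : (SimpleGraph.fromRel fun μ ν : V =>
    ∃ e : E, vertex (e, false) = μ ∧ vertex (e, true) = ν).Connected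
  next : Equiv.Perm (E × Bool)
  sameCycle_iff : ∀ h h' : E × Bool, next.SameCycle h h' ↔ vertex h = vertex h'
  /-- The multiplicity function. -/
  mult : V → ℕ
  mult_pos : ∀ ν, 0 < mult ν

namespace BrauerGraph

noncomputable section

variable {V E : Type*} (G : BrauerGraph V E)

/-- The valency of a vertex: the number of half-edges attached to it (a loop counts twice). -/
def valency (ν : V) : ℕ := Nat.card {h : E × Bool // G.vertex h = ν}

/-- The half-edge `h` is attached to a vertex of valency one and multiplicity one. No arrow of the
quiver arises at such a vertex. -/
def IsTruncated (h : E × Bool) : Prop :=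
  G.valency (G.vertex h) = 1 ∧ G.mult (G.vertex h) = 1

/-- The Brauer graphs of the algebras `k` and `k[x]/(x²)`, which are not covered by the general
construction: a single vertex without edges, or an edge with two distinct end points which are both
of valency one and multiplicity one (being connected, the graph then has no other edge). -/
def IsExceptional : Prop :=
  IsEmpty E ∨ ∃ e : E, G.IsTruncated (e, false) ∧ G.IsTruncated (e, true)

/-- The half-edges that give rise to arrows. -/
abbrev ArrowIndex := {h : E × Bool // ¬ G.IsTruncated h}

theorem vertex_next (h : E × Bool) : G.vertex (G.next h) = G.vertex h :=
  ((G.sameCycle_iff _ _).1 ⟨1, by simp⟩).symm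

/-- The successor in the cyclic ordering, on the half-edges that give rise to arrows. -/
def nextArrow (a : G.ArrowIndex) : G.ArrowIndex :=
  ⟨G.next a.1, by simpa only [IsTruncated, vertex_next] using a.2⟩

/-- The vertex set of the quiver `Q_Γ`: the edges of `Γ`. -/
def QuiverVertex (_ : BrauerGraph V E) := E

instance [Fintype E] : Fintype G.QuiverVertex := inferInstanceAs (Fintype E)

/-- The source of an arrow: the edge of its half-edge. -/
def src (a : G.ArrowIndex) : G.QuiverVertex := a.1.1

/-- The target of an arrow: the edge of the successor of its half-edge. -/
def tgt (a : G.ArrowIndex) : G.QuiverVertex := (G.nextArrow a).1.1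

/-- The quiver `Q_Γ`: a (non-truncated) half-edge `h` of the edge `i` whose direct successor is a
half-edge of the edge `j` is an arrow `i ⟶ j`. In particular a vertex of valency one and
multiplicity at least two gives a loop. -/
instance : Quiver G.QuiverVertex where
  Hom i j := {a : G.ArrowIndex // G.src a = i ∧ G.tgt a = j}

/-- The arrow attached to a half-edge. -/
def arrow (a : G.ArrowIndex) : G.src a ⟶ G.tgt a := ⟨a, rfl, rfl⟩

variable (k : Type*) [Field k] [Fintype E]

/-- The arrow attached to a half-edge, as an element of the path algebra. -/
def arrowElt (a : G.ArrowIndex) : PathAlgebra k G.QuiverVertex :=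
  PathAlgebra.ofPath k (G.arrow a).toPath

/-- The cycle `C_ν`, starting with the arrow of the half-edge `a` at the vertex `ν`: it runs once
through all arrows at `ν`, in the cyclic ordering. -/
def cycle (a : G.ArrowIndex) : PathAlgebra k G.QuiverVertex :=
  ((List.range (G.valency (G.vertex a.1))).map fun n => G.arrowElt k (G.nextArrow^[n] a)).prod

/-- The power `C_ν^{e(ν)}` of the cycle starting with the arrow of `a`. -/
def cyclePow (a : G.ArrowIndex) : PathAlgebra k G.QuiverVertex :=
  G.cycle k a ^ G.mult (G.vertex a.1)

/-- The relations `ρ_Γ` of the Brauer graph algebra. -/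
inductive Relation : PathAlgebra k G.QuiverVertex → Prop
  /-- `C_ν^{e(ν)} - C_ν'^{e(ν')}` for an edge both of whose half-edges carry cycles. -/
  | comm (a b : G.ArrowIndex) (hedge : G.src a = G.src b) (hne : a ≠ b) :
      Relation (G.cyclePow k a - G.cyclePow k b)
  /-- `C_ν'^{e(ν')} α`, with `α` the first arrow of `C_ν'`, for an edge whose other half-edge is
  truncated. -/
  | trunc (a : G.ArrowIndex) (ha : G.IsTruncated (a.1.1, !a.1.2)) :
      Relation (G.cyclePow k a * G.arrowElt k a)
  /-- `α β` for composable arrows such that `β` does not follow `α` in the cycle of `α`. -/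
  | zero (a b : G.ArrowIndex) (hcomp : G.tgt a = G.src b) (hne : b ≠ G.nextArrow a) :
      Relation (G.arrowElt k a * G.arrowElt k b)

/-- The ideal `I_Γ` generated by the relations. -/
def relIdeal : TwoSidedIdeal (PathAlgebra k G.QuiverVertex) :=
  TwoSidedIdeal.span {x | G.Relation k x}

end

end BrauerGraph

/-- The Brauer graph algebra `B_Γ = kQ_Γ / I_Γ`. -/
abbrev BrauerGraphAlgebra (k : Type*) {V E : Type*} [Field k] [Fintype E] (G : BrauerGraph V E) :=
  BoundQuiverAlgebra k (G.relIdeal k)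

/-! The algebra `A` comes from an admissible cut: a set `D` containing exactly one arrow of each
cycle `C_ν`. Delete the arrows of `D` from `Q_Γ` and keep as relations only the products of two
arrows that do not follow each other in the cyclic ordering (`cutIdeal`). Since a half-edge has one
successor and an edge has two half-edges, this bound quiver is gentle.

To compare `B_Γ` with `T(A)`, three maps are used. Killing the arrows of `D` gives `π : B_Γ → A`,
because every full cycle meets `D`; including the remaining arrows gives a section `s` of `π`. The
linear form `t` that is one on full cycles and zero on all other paths is symmetric and kills the
relations, so it descends to `B_Γ`. The map `b ↦ (π b, t (b * s ·))` is then a homomorphism to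
`T(A)`, provided that `t` vanishes on `s A` and on products of two elements of `ker π`
(`ofTraceForm`).

Bijectivity follows from dual families. The algebra `A` is spanned by the trivial paths and the
walks along cycles that avoid `D`. Each of them has a complement: the rest of its cycle or, for a
trivial path, a full cycle at that edge. The complements meet `D`, hence lie in `ker π`, and the
pairing of complements with walks under `t` is the identity matrix. As all multiplicities are one, a
full cycle meets `D` only once, so `t` vanishes on a product of two complements. Walks and
complements together span `B_Γ`, which gives the isomorphism (`nonempty_algEquiv_of_dualFamily`,
`finite_and_nonempty_algEquiv`).

No basis theorem for `A` or `B_Γ` is needed beforehand: linear independence is read off from the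
pairing. The same pairing shows that walks avoiding `D` are nonzero in `A`, as gentleness condition
`s4` requires. -/

/-! ### Recognising trivial extensions by a trace form -/

namespace TrivialExtension

variable {k A B X : Type*} [Field k] [Ring A] [Algebra k A] [Ring B] [Algebra k B]

/-- The homomorphism `b ↦ (π b, a ↦ t (b * s a))` to the trivial extension, for a split
epimorphism `π` with section `s` and a trace form `t` that vanishes on `s A` and on the square of
the kernel of `π`. -/
def ofTraceForm (π : B →ₐ[k] A) (s : A →ₐ[k] B) (hπs : ∀ a, π (s a) = a) (t : B →ₗ[k] k)
    (hsymm : ∀ x y, t (x * y) = t (y * x)) (hts : ∀ a, t (s a) = 0)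
    (hker : ∀ x y, π x = 0 → π y = 0 → t (x * y) = 0) : B →ₐ[k] TrivialExtension k A :=
  let φ : B →ₗ[k] DualBimodule k A :=
    { toFun := fun b => show A →ₗ[k] k from (t ∘ₗ LinearMap.mulLeft k b) ∘ₗ s.toLinearMap
      map_add' := fun x y => by
        ext a; change t ((x + y) * s a) = t (x * s a) + t (y * s a); rw [add_mul, map_add]
      map_smul' := fun c x => by
        ext a; change t ((c • x) * s a) = c * t (x * s a); simp }
  AlgHom.ofLinearMap
    { toFun := fun b => (π b, φ b)
      map_add' := fun x y => by rw [map_add, map_add]; rfl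
      map_smul' := fun c x => by rw [map_smul, map_smul]; rfl }
    (by
      refine Prod.ext (map_one π) ?_
      ext a
      change t (1 * s a) = 0
      rw [one_mul, hts])
    (by
      intro x y
      refine Prod.ext (map_mul π x y) ?_
      ext a
      change t (x * y * s a) = t (y * s (a * π x)) + t (x * s (π y * a))
      -- The defect of multiplicativity is `t` of a product of two elements of `ker π`, up to the
      -- term `t (s (π x * π y * a))`, which vanishes because `t` is zero on `s A`.
      have h : t ((x - s (π x)) * ((y - s (π y)) * s a)) = 0 := by
        apply hker <;> simp [hπs]
      have h1 : t (s (π x) * (s (π y) * s a)) = 0 := by rw [← map_mul, ← map_mul, hts]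
      have h2 : t (y * (s a * s (π x))) = t (s (π x) * (y * s a)) := by
        rw [← mul_assoc, hsymm]
      simp only [sub_mul, mul_sub, map_sub] at h
      rw [map_mul s, map_mul s, h2, mul_assoc]
      linear_combination h - h1)

theorem fst_ofTraceForm (π : B →ₐ[k] A) (s : A →ₐ[k] B) (hπs) (t : B →ₗ[k] k) (hsymm) (hts) (hker)
    (b : B) : (ofTraceForm π s hπs t hsymm hts hker b).fst = π b := rfl

theorem snd_ofTraceForm_apply (π : B →ₐ[k] A) (s : A →ₐ[k] B) (hπs) (t : B →ₗ[k] k) (hsymm) (hts)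
    (hker) (b : B) (a : A) :
    (ofTraceForm π s hπs t hsymm hts hker b).snd a = t (b * s a) := rfl

variable (π : B →ₐ[k] A) (s : A →ₐ[k] B) (hπs : ∀ a, π (s a) = a)
  (q : X → A) (c : X → B) (hπc : ∀ x, π (c x) = 0)
  (hspan : Submodule.span k (Set.range (s ∘ q) ∪ Set.range c) = ⊤)

include hπs hπc hspan in
theorem span_range_eq_top : Submodule.span k (Set.range q) = ⊤ := by
  rw [eq_top_iff]
  intro a _
  have h : s a ∈ Submodule.span k (Set.range (s ∘ q) ∪ Set.range c) := hspan ▸ trivial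
  have h' := Submodule.mem_map_of_mem (f := π.toLinearMap) h
  rw [Submodule.map_span] at h'
  simp only [AlgHom.toLinearMap_apply, hπs] at h'
  refine Submodule.span_le.2 ?_ h'
  rintro _ ⟨_, ⟨x, rfl⟩ | ⟨x, rfl⟩, rfl⟩
  · exact Submodule.subset_span ⟨x, by simp [hπs]⟩
  · simp [hπc]

include hπs hπc hspan in
-- Split `b` into a part in `s A` and a part in the span of `c`. Since `π` kills the latter and is
-- inverse to `s` on the former, the part in `s A` vanishes.
theorem ker_le_span {b : B} (hb : π b = 0) : b ∈ Submodule.span k (Set.range c) := by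
  have h : b ∈ Submodule.span k (Set.range (s ∘ q) ∪ Set.range c) := hspan ▸ trivial
  rw [Submodule.span_union, Submodule.mem_sup] at h
  obtain ⟨y, hy, z, hz, rfl⟩ := h
  have hz0 : π z = 0 := by
    have : Submodule.span k (Set.range c) ≤ LinearMap.ker π.toLinearMap := by
      rw [Submodule.span_le]
      rintro _ ⟨x, rfl⟩
      exact hπc x
    exact this hz
  have hy' : y ∈ LinearMap.range s.toLinearMap := by
    refine Submodule.span_le.2 ?_ hy
    rintro _ ⟨x, rfl⟩
    exact ⟨q x, rfl⟩
  obtain ⟨a, rfl⟩ := hy'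
  rw [AlgHom.toLinearMap_apply, map_add, hπs, hz0, add_zero] at hb
  simpa [hb] using hz

include hπs hπc hspan in
/-- A criterion for an algebra `B` to be the trivial extension of `A`. -/
theorem nonempty_algEquiv_of_dualFamily [Finite X] [DecidableEq X] (t : B →ₗ[k] k)
    (hsymm : ∀ x y, t (x * y) = t (y * x)) (htq : ∀ x, t (s (q x)) = 0)
    (htc : ∀ x y, t (c x * c y) = 0)
    (hdual : ∀ x y, t (c x * s (q y)) = if x = y then 1 else 0) :
    Nonempty (B ≃ₐ[k] TrivialExtension k A) := by
  classical
  have := Fintype.ofFinite X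
  have hq := span_range_eq_top π s hπs q c hπc hspan
  have hts : ∀ a, t (s a) = 0 := by
    intro a
    have h : a ∈ Submodule.span k (Set.range q) := hq ▸ trivial
    have : Submodule.span k (Set.range q) ≤ LinearMap.ker (t ∘ₗ s.toLinearMap) := by
      rw [Submodule.span_le]
      rintro _ ⟨x, rfl⟩
      exact htq x
    exact this h
  have hker : ∀ x y, π x = 0 → π y = 0 → t (x * y) = 0 := by
    intro x y hx hy
    have hx' := ker_le_span π s hπs q c hπc hspan hx
    have hy' := ker_le_span π s hπs q c hπc hspan hy
    obtain ⟨f, rfl⟩ := (Submodule.mem_span_range_iff_exists_fun k).1 hx'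
    obtain ⟨g, rfl⟩ := (Submodule.mem_span_range_iff_exists_fun k).1 hy'
    simp [Finset.sum_mul, Finset.mul_sum, htc]
  refine ⟨AlgEquiv.ofBijective (ofTraceForm π s hπs t hsymm hts hker) ⟨?_, ?_⟩⟩
  · rw [injective_iff_map_eq_zero]
    intro b hb
    have hb0 : π b = 0 := congrArg TrivSqZeroExt.fst hb
    obtain ⟨f, rfl⟩ := (Submodule.mem_span_range_iff_exists_fun k).1
      (ker_le_span π s hπs q c hπc hspan hb0)
    -- Evaluating the functional of `b` at `q y` reads off the coefficient of `c y`.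
    have hf : ∀ y, f y = 0 := by
      intro y
      have h := DFunLike.congr_fun (congrArg TrivSqZeroExt.snd hb) (q y)
      rw [snd_ofTraceForm_apply] at h
      simpa [Finset.sum_mul, hdual] using h
    simp [hf]
  · intro z
    -- The section supplies the first component and contributes no functional, as `t` vanishes on `s
    -- A`; the dual family then realises the prescribed functional.
    refine ⟨s z.fst + ∑ x, z.snd (q x) • c x, TrivSqZeroExt.ext ?_ ?_⟩
    · rw [fst_ofTraceForm]
      simp [hπs, hπc]
    · ext a
      have h : a ∈ Submodule.span k (Set.range q) := hq ▸ trivial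
      obtain ⟨f, rfl⟩ := (Submodule.mem_span_range_iff_exists_fun k).1 h
      rw [snd_ofTraceForm_apply, add_mul, map_add, ← map_mul, hts, zero_add]
      have hz : z.snd (∑ x, f x • q x) = ∑ x, f x * z.snd (q x) :=
        (map_sum (show A →ₗ[k] k from z.snd) _ _).trans
          (Finset.sum_congr rfl fun x _ => DualBimodule.map_ksmul' _ _ _)
      rw [hz]
      simp [Finset.sum_mul, Finset.mul_sum, hdual]

end TrivialExtension

/-! ### The universal property of path algebras -/

namespace PathAlgebra

noncomputable section

variable {k Q R : Type*} [Field k] [Quiver Q] [Ring R] [Algebra k R]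

theorem ofPath_cons {i j l : Q} (p : Quiver.Path i j) (f : j ⟶ l) :
    ofPath k (p.cons f) = ofPath k p * ofPath k f.toPath := by
  rw [ofPath_mul_ofPath]; rfl

theorem algHom_ext_paths [Fintype Q] {f g : PathAlgebra k Q →ₐ[k] R}
    (h : ∀ (i j : Q) (p : Quiver.Path i j), f (ofPath k p) = g (ofPath k p)) : f = g := by
  ext x
  induction x using induction_on with
  | zero => simp
  | add x y hx hy => rw [map_add, map_add, hx, hy]
  | smul c i j p => rw [map_smul, map_smul, h]

theorem algHom_ext [Fintype Q] {f g : PathAlgebra k Q →ₐ[k] R}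
    (h0 : ∀ i : Q, f (ofPath k (.nil : Quiver.Path i i)) =
      g (ofPath k (.nil : Quiver.Path i i)))
    (h1 : ∀ (i j : Q) (a : i ⟶ j), f (ofPath k a.toPath) = g (ofPath k a.toPath)) : f = g := by
  refine algHom_ext_paths fun i j p => ?_
  induction p with
  | nil => exact h0 i
  | cons p a ih => rw [ofPath_cons, map_mul, map_mul, ih, h1]

variable (Q R) in
/-- The images of the trivial paths and of the arrows under a homomorphism from a path algebra. -/
structure LiftData [Fintype Q] where
  /-- The images of the trivial paths. -/
  idem : Q → R
  /-- The images of the arrows. -/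
  arr : ∀ {i j : Q}, (i ⟶ j) → R
  idem_mul_idem : ∀ i, idem i * idem i = idem i
  idem_mul_of_ne : ∀ i j, i ≠ j → idem i * idem j = 0
  sum_idem : ∑ i, idem i = 1
  idem_mul_arr : ∀ {i j : Q} (a : i ⟶ j), idem i * arr a = arr a
  arr_mul_idem : ∀ {i j : Q} (a : i ⟶ j), arr a * idem j = arr a

namespace LiftData

variable [Fintype Q] (d : LiftData Q R)

/-- The image of a path. -/
def evalPath {i : Q} : {j : Q} → Quiver.Path i j → R
  | _, .nil => d.idem i
  | _, .cons p a => evalPath p * d.arr a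

theorem idem_mul_evalPath {i j : Q} (p : Quiver.Path i j) :
    d.idem i * d.evalPath p = d.evalPath p := by
  induction p with
  | nil => exact d.idem_mul_idem i
  | cons p a ih => rw [evalPath, ← mul_assoc, ih]

theorem evalPath_mul_idem {i j : Q} (p : Quiver.Path i j) :
    d.evalPath p * d.idem j = d.evalPath p := by
  cases p with
  | nil => exact d.idem_mul_idem i
  | cons p a => rw [evalPath, mul_assoc, d.arr_mul_idem]

theorem evalPath_comp {i j l : Q} (p : Quiver.Path i j) (q : Quiver.Path j l) :
    d.evalPath (p.comp q) = d.evalPath p * d.evalPath q := by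
  induction q with
  | nil => rw [Quiver.Path.comp_nil, evalPath, evalPath_mul_idem]
  | cons q a ih => rw [Quiver.Path.comp_cons, evalPath, evalPath, ih, mul_assoc]

theorem evalPath_mul_of_ne {i j i' j' : Q} (p : Quiver.Path i j) (q : Quiver.Path i' j')
    (h : j ≠ i') : d.evalPath p * d.evalPath q = 0 := by
  rw [← d.evalPath_mul_idem p, ← d.idem_mul_evalPath q, mul_assoc, ← mul_assoc (d.idem j),
    d.idem_mul_of_ne _ _ h, zero_mul, mul_zero]

variable (k) in
/-- The linear extension of the evaluation of paths. -/
def lin : PathAlgebra k Q →ₗ[k] R := (basis k Q).constr k fun p => d.evalPath p.2.2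

theorem lin_ofPath {i j : Q} (p : Quiver.Path i j) : d.lin k (ofPath k p) = d.evalPath p := by
  rw [lin, ofPath, Module.Basis.constr_basis]

theorem lin_mul (x y : PathAlgebra k Q) : d.lin k (x * y) = d.lin k x * d.lin k y := by
  induction x using induction_on with
  | zero => simp
  | add x x' hx hx' => rw [add_mul, map_add, map_add, hx, hx', add_mul]
  | smul a i j p =>
  induction y using induction_on with
  | zero => simp
  | add y y' hy hy' => rw [mul_add, map_add, map_add, hy, hy', mul_add]
  | smul b i' j' q =>
  rw [smul_mul_assoc, mul_smul_comm, map_smul, map_smul, map_smul, map_smul, smul_mul_assoc,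
    mul_smul_comm, lin_ofPath, lin_ofPath]
  congr 2
  by_cases h : j = i'
  · subst h
    rw [ofPath_mul_ofPath, lin_ofPath, evalPath_comp]
  · rw [ofPath_mul_ofPath_of_ne _ _ h, map_zero, evalPath_mul_of_ne _ _ _ h]

variable (k) in
/-- The homomorphism from the path algebra with the given values. -/
def lift : PathAlgebra k Q →ₐ[k] R :=
  AlgHom.ofLinearMap (d.lin k)
    (by rw [one_def, map_sum, ← d.sum_idem]
        exact Finset.sum_congr rfl fun i _ => d.lin_ofPath _) d.lin_mul

theorem lift_nil (i : Q) : d.lift k (ofPath k (.nil : Quiver.Path i i)) = d.idem i :=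
  d.lin_ofPath _

theorem lift_arrow {i j : Q} (a : i ⟶ j) : d.lift k (ofPath k a.toPath) = d.arr a :=
  (d.lin_ofPath _).trans (d.idem_mul_arr a)

end LiftData

end

end PathAlgebra

/-! ### Homomorphisms and trace forms on quotients `kQ/I` -/

namespace BoundQuiverAlgebra

variable {k Q R : Type*} [Field k] [Quiver Q] [Fintype Q] [Ring R] [Algebra k R]
  (I : TwoSidedIdeal (PathAlgebra k Q))

/-- The projection from the path algebra. -/
noncomputable def toQuot : PathAlgebra k Q →ₐ[k] BoundQuiverAlgebra k I := I.ringCon.mkₐ k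

theorem toQuot_surjective : Function.Surjective (toQuot I) := fun x => by
  obtain ⟨y, rfl⟩ := RingCon.mk'_surjective _ x
  exact ⟨y, rfl⟩

theorem toQuot_eq_zero_iff {x : PathAlgebra k Q} : toQuot I x = 0 ↔ x ∈ I := by
  rw [← map_zero (toQuot I), TwoSidedIdeal.mem_iff]
  exact RingCon.eq _

/-- Homomorphisms that vanish on a generating set of the ideal factor over the quotient. -/
theorem exists_lift_of_span {S : Set (PathAlgebra k Q)} (hS : I = TwoSidedIdeal.span S)
    (f : PathAlgebra k Q →ₐ[k] R) (h : ∀ x ∈ S, f x = 0) :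
    ∃ g : BoundQuiverAlgebra k I →ₐ[k] R, ∀ x, g (toQuot I x) = f x := by
  have hle : I ≤ TwoSidedIdeal.ker f := by
    rw [hS, TwoSidedIdeal.span_le]
    exact fun x hx => (TwoSidedIdeal.mem_ker f).2 (h x hx)
  have hle' : I.ringCon ≤ RingCon.ker f.toRingHom := fun x y hxy => by
    rw [TwoSidedIdeal.rel_iff] at hxy
    have := (TwoSidedIdeal.mem_ker f).1 (hle hxy)
    rw [map_sub, sub_eq_zero] at this
    exact this
  exact ⟨I.ringCon.liftₐ f hle', fun x => rfl⟩

/-- A trace form on the path algebra that vanishes on generators of the ideal factors over the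
quotient. -/
theorem exists_trace_of_span {S : Set (PathAlgebra k Q)} (hS : I = TwoSidedIdeal.span S)
    (t : PathAlgebra k Q →ₗ[k] k) (hsymm : ∀ x y, t (x * y) = t (y * x))
    (h : ∀ x ∈ S, ∀ y, t (x * y) = 0) :
    ∃ t' : BoundQuiverAlgebra k I →ₗ[k] k, (∀ x y, t' (x * y) = t' (y * x)) ∧
      ∀ x, t' (toQuot I x) = t x := by
  -- The radical of the form `(x, y) ↦ t (x * y)`. Symmetry of `t` makes this right ideal two-sided,
  -- so it contains `I` as soon as it contains the generators.
  let J : TwoSidedIdeal (PathAlgebra k Q) := TwoSidedIdeal.mk' {x | ∀ y, t (x * y) = 0}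
    (fun y => by simp) (fun {x x'} hx hx' y => by rw [add_mul, map_add, hx, hx', add_zero])
    (fun {x} hx y => by rw [neg_mul, map_neg, hx, neg_zero])
    (fun {x x'} hx y => by rw [mul_assoc, hsymm, mul_assoc, hx])
    (fun {x x'} hx y => by rw [mul_assoc, hx])
  have hle : I ≤ J := by
    rw [hS, TwoSidedIdeal.span_le]
    intro x hx
    simp only [J, TwoSidedIdeal.coe_mk']
    exact h x hx
  have hI : ∀ x ∈ I, t x = 0 := by
    intro x hx
    have := hle hx
    rw [TwoSidedIdeal.mem_mk'] at this
    simpa using this 1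
  obtain ⟨r, hr⟩ := (toQuot I).toLinearMap.exists_rightInverse_of_surjective
    (LinearMap.range_eq_top.2 (toQuot_surjective I))
  have hr' : ∀ x, toQuot I (r x) = x := fun x => LinearMap.congr_fun hr x
  have key : ∀ x, t (r (toQuot I x)) = t x := by
    intro x
    rw [← sub_eq_zero, ← map_sub]
    apply hI
    rw [← toQuot_eq_zero_iff, map_sub, hr', sub_self]
  refine ⟨t ∘ₗ r, fun x y => ?_, key⟩
  obtain ⟨x, rfl⟩ := toQuot_surjective I x
  obtain ⟨y, rfl⟩ := toQuot_surjective I y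
  rw [← map_mul, ← map_mul]
  exact (key _).trans ((hsymm x y).trans (key _).symm)

end BoundQuiverAlgebra

/-! ### Cycles around vertices and admissible cuts -/

namespace BrauerGraph

variable {V E : Type*} (G : BrauerGraph V E)

theorem vertex_iterate_next (n : ℕ) (h : E × Bool) : G.vertex (G.next^[n] h) = G.vertex h := by
  induction n with
  | zero => rfl
  | succ n ih => rw [Function.iterate_succ_apply', vertex_next, ih]

/-- The half-edges at a vertex form a single orbit of `next`, so counting them amounts to finding
the period of any one of them. -/
theorem valency_eq_minimalPeriod [Finite E] (h : E × Bool) :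
    G.valency (G.vertex h) = Function.minimalPeriod G.next h := by
  have hpos : 0 < Function.minimalPeriod G.next h :=
    Function.minimalPeriod_pos_of_mem_periodicPts
      (Function.Injective.mem_periodicPts G.next.injective h)
  rw [valency, ← Nat.card_fin (Function.minimalPeriod G.next h)]
  symm
  refine Nat.card_eq_of_bijective
    (fun n : Fin _ => ⟨G.next^[n] h, G.vertex_iterate_next n h⟩) ⟨fun m n hmn => ?_, fun x => ?_⟩
  · exact Fin.ext (Function.iterate_injOn_Iio_minimalPeriod m.2 n.2 (congrArg Subtype.val hmn))
  · obtain ⟨n, hn⟩ := ((G.sameCycle_iff h x.1).2 x.2.symm).exists_nat_pow_eq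
    refine ⟨⟨n % _, Nat.mod_lt _ hpos⟩, Subtype.ext ?_⟩
    rw [Equiv.Perm.coe_pow] at hn
    simp only [Function.iterate_mod_minimalPeriod_eq]
    exact hn

theorem iterate_nextArrow_val (n : ℕ) (a : G.ArrowIndex) :
    (G.nextArrow^[n] a).1 = G.next^[n] a.1 := by
  induction n with
  | zero => rfl
  | succ n ih => rw [Function.iterate_succ_apply', Function.iterate_succ_apply', ← ih]; rfl

theorem nextArrow_injective : Function.Injective G.nextArrow := fun _ _ h =>
  Subtype.ext (G.next.injective (congrArg Subtype.val h))

/-- The number of arrows in the cycle of `a`. -/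
noncomputable def period (a : G.ArrowIndex) : ℕ := G.valency (G.vertex a.1)

theorem period_iterate (n : ℕ) (a : G.ArrowIndex) :
    G.period (G.nextArrow^[n] a) = G.period a := by
  rw [period, iterate_nextArrow_val, vertex_iterate_next, period]

variable [Finite E]

theorem period_pos (a : G.ArrowIndex) : 0 < G.period a := by
  rw [period, valency_eq_minimalPeriod]
  exact Function.minimalPeriod_pos_of_mem_periodicPts
      (Function.Injective.mem_periodicPts G.next.injective _)

@[simp] theorem iterate_period (a : G.ArrowIndex) : G.nextArrow^[G.period a] a = a := by
  apply Subtype.ext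
  rw [iterate_nextArrow_val, period, valency_eq_minimalPeriod, Function.iterate_minimalPeriod]

theorem iterate_inj {a : G.ArrowIndex} {m n : ℕ} (hm : m < G.period a) (hn : n < G.period a)
    (h : G.nextArrow^[m] a = G.nextArrow^[n] a) : m = n := by
  rw [period, valency_eq_minimalPeriod] at hm hn
  have h' := congrArg Subtype.val h
  rw [iterate_nextArrow_val, iterate_nextArrow_val] at h'
  exact Function.iterate_injOn_Iio_minimalPeriod hm hn h'

theorem exists_iterate_eq {a b : G.ArrowIndex} (h : G.vertex a.1 = G.vertex b.1) :
    ∃ n < G.period a, G.nextArrow^[n] a = b := by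
  obtain ⟨n, hn⟩ := ((G.sameCycle_iff a.1 b.1).2 h).exists_nat_pow_eq
  refine ⟨n % G.period a, Nat.mod_lt _ (G.period_pos a), Subtype.ext ?_⟩
  rw [Equiv.Perm.coe_pow] at hn
  rw [iterate_nextArrow_val, period, valency_eq_minimalPeriod,
    Function.iterate_mod_minimalPeriod_eq, hn]

theorem period_le_card (a : G.ArrowIndex) : G.period a ≤ Nat.card (E × Bool) :=
  Nat.card_le_card_of_injective _ Subtype.val_injective

omit [Finite E] in
/-- An admissible cut: a set of arrows that contains exactly one arrow of each cycle. -/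
def IsAdmissibleCut (D : Set G.ArrowIndex) : Prop :=
  ∀ a, ∃! n, n < G.period a ∧ G.nextArrow^[n] a ∈ D

theorem exists_isAdmissibleCut : ∃ D, G.IsAdmissibleCut D := by
  let r (a : G.ArrowIndex) : G.ArrowIndex :=
    (⟨a, rfl⟩ : ∃ b : G.ArrowIndex, G.vertex b.1 = G.vertex a.1).choose
  have hr : ∀ a, G.vertex (r a).1 = G.vertex a.1 := fun a =>
    (⟨a, rfl⟩ : ∃ b : G.ArrowIndex, G.vertex b.1 = G.vertex a.1).choose_spec
  -- The choice is made from an existence statement that depends on `a` only through its vertex, so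
  -- `r` picks one representative per vertex.
  have hrr : ∀ a b : G.ArrowIndex, G.vertex a.1 = G.vertex b.1 → r a = r b := by
    intro a b h
    simp only [r, h]
  refine ⟨Set.range r, fun a => ?_⟩
  obtain ⟨n, hn, h⟩ := G.exists_iterate_eq (hr a).symm
  refine ⟨n, ⟨hn, a, h.symm⟩, ?_⟩
  rintro m ⟨hm, b, hb⟩
  refine G.iterate_inj hm hn ?_
  rw [h, ← hb]
  apply hrr
  rw [← hr b, hb, iterate_nextArrow_val, vertex_iterate_next]

namespace IsAdmissibleCut

variable {G} {D : Set G.ArrowIndex} (hD : G.IsAdmissibleCut D)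

include hD

omit [Finite E] in
theorem lt_period {a : G.ArrowIndex} {n : ℕ} (h : ∀ m < n, G.nextArrow^[m] a ∉ D) :
    n < G.period a := by
  obtain ⟨m, ⟨hm, hmD⟩, -⟩ := hD a
  by_contra hn
  exact h m (by lia) hmD

omit [Finite E] in
theorem exists_mem_complement {a : G.ArrowIndex} {n : ℕ} (h : ∀ m < n, G.nextArrow^[m] a ∉ D) :
    ∃ m < G.period a - n, G.nextArrow^[m] (G.nextArrow^[n] a) ∈ D := by
  obtain ⟨m, ⟨hm, hmD⟩, -⟩ := hD a
  have hnm : n ≤ m := by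
    by_contra hn
    exact h m (by lia) hmD
  refine ⟨m - n, by lia, ?_⟩
  rwa [← Function.iterate_add_apply, Nat.sub_add_cancel hnm]

omit [Finite E] in
-- The cycle meets `D` only once, so if an initial piece meets `D`, the remaining piece avoids it.
theorem notMem_complement {a : G.ArrowIndex} {m n : ℕ} (hm : m < n)
    (h : G.nextArrow^[m] a ∈ D) :
    ∀ l < G.period a - n, G.nextArrow^[l] (G.nextArrow^[n] a) ∉ D := by
  intro l hl hlD
  rw [← Function.iterate_add_apply] at hlD
  have := (hD a).unique ⟨by lia, h⟩ ⟨by lia, hlD⟩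
  lia

omit [Finite E] in
theorem eq_of_mem {a : G.ArrowIndex} {m n : ℕ} (hm : m < G.period a) (hn : n < G.period a)
    (hmD : G.nextArrow^[m] a ∈ D) (hnD : G.nextArrow^[n] a ∈ D) : m = n :=
  (hD a).unique ⟨hm, hmD⟩ ⟨hn, hnD⟩

end IsAdmissibleCut

/-! ### Arrow lists of paths and recognition of full cycles -/

noncomputable section

/-- The list of the arrows of a path. -/
def arrowList {i : G.QuiverVertex} : {j : G.QuiverVertex} → Quiver.Path i j → List G.ArrowIndex
  | _, .nil => []
  | _, .cons p f => arrowList p ++ [f.1]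

omit [Finite E]

theorem arrowList_comp {i j l : G.QuiverVertex} (p : Quiver.Path i j) (q : Quiver.Path j l) :
    G.arrowList (p.comp q) = G.arrowList p ++ G.arrowList q := by
  induction q with
  | nil => simp [arrowList]
  | cons q f ih => rw [Quiver.Path.comp_cons, arrowList, ih, arrowList, List.append_assoc]

theorem src_eq_of_arrowList {i j : G.QuiverVertex} (p : Quiver.Path i j) {a : G.ArrowIndex}
    {l : List G.ArrowIndex} (h : G.arrowList p = a :: l) : G.src a = i := by
  induction p generalizing l with
  | nil => simp [arrowList] at h
  | cons p f ih =>
    rw [arrowList] at h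
    cases hp : G.arrowList p with
    | nil =>
      rw [hp] at h
      cases p with
      | nil =>
        simp only [List.nil_append, List.cons.injEq] at h
        rw [← h.1]
        exact f.2.1
      | cons p g => simp [arrowList] at hp
    | cons b l' =>
      rw [hp, List.cons_append, List.cons.injEq] at h
      exact ih (h.1 ▸ hp)

theorem tgt_eq_of_arrowList {i j : G.QuiverVertex} (p : Quiver.Path i j) {a : G.ArrowIndex}
    {l : List G.ArrowIndex} (h : G.arrowList p = l ++ [a]) : G.tgt a = j := by
  cases p with
  | nil => simp [arrowList] at h
  | cons p f =>
    rw [arrowList] at h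
    rw [← (List.append_inj' h rfl).2 |> List.singleton_injective]
    exact f.2.2

theorem iterate_succ_last (a : G.ArrowIndex) (n : ℕ) :
    List.iterate G.nextArrow a (n + 1) = List.iterate G.nextArrow a n ++ [G.nextArrow^[n] a] := by
  rw [List.iterate_add]; rfl

/-- The list of arrows forgets the endpoints of a trivial path, hence the assumption `0 < n`;
otherwise the first and last arrows recover them. -/
theorem endpoints_of_arrowList {i j : G.QuiverVertex} (p : Quiver.Path i j) {a : G.ArrowIndex}
    {n : ℕ} (hn : 0 < n) (h : G.arrowList p = List.iterate G.nextArrow a n) :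
    i = G.src a ∧ j = G.src (G.nextArrow^[n] a) := by
  obtain ⟨n, rfl⟩ := Nat.exists_eq_add_one.2 hn
  refine ⟨(G.src_eq_of_arrowList p h).symm, ?_⟩
  rw [iterate_succ_last] at h
  rw [← G.tgt_eq_of_arrowList p h, Function.iterate_succ_apply']
  rfl

/-- The list consists of the arrows of a cycle. -/
def IsCycleList (l : List G.ArrowIndex) : Prop := ∃ a, l = List.iterate G.nextArrow a (G.period a)

/-- A rotated cycle is the cycle that starts at a later arrow. This is the source of the symmetry of
the trace form. -/
theorem IsCycleList.rotate [Finite E] {G : BrauerGraph V E} {l l' : List G.ArrowIndex}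
    (h : G.IsCycleList (l ++ l')) : G.IsCycleList (l' ++ l) := by
  obtain ⟨a, ha⟩ := h
  have hlen := congrArg List.length ha
  rw [List.length_append, List.length_iterate] at hlen
  rw [← hlen, List.iterate_add] at ha
  obtain ⟨h1, h2⟩ := List.append_inj ha (by simp)
  refine ⟨G.nextArrow^[l.length] a, ?_⟩
  rw [period_iterate, ← hlen, add_comm, List.iterate_add, ← h2, ← Function.iterate_add_apply,
    add_comm l'.length, hlen, iterate_period, ← h1]

/-- A piece of a cycle determines the cycle. -/
theorem eq_of_iterate_append {a b : G.ArrowIndex} {n : ℕ} {l : List G.ArrowIndex} (hn : 0 < n)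
    (h : List.iterate G.nextArrow a n ++ l = List.iterate G.nextArrow b (G.period b)) :
    a = b ∧ n + l.length = G.period a ∧
      l = List.iterate G.nextArrow (G.nextArrow^[n] a) l.length := by
  have hlen := congrArg List.length h
  rw [List.length_append, List.length_iterate, List.length_iterate] at hlen
  have h' := h
  rw [← hlen, List.iterate_add] at h'
  obtain ⟨h1, h2⟩ := List.append_inj h' (by simp)
  obtain ⟨n, rfl⟩ := Nat.exists_eq_add_one.2 hn
  have hab : a = b := (List.cons.inj h1).1
  subst hab
  exact ⟨rfl, hlen, h2⟩

/-- As `0 < n`, the list shows its first arrow `a`, and a full cycle is determined by its first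
arrow. -/
theorem isCycleList_append_iff {a : G.ArrowIndex} {n : ℕ} {l : List G.ArrowIndex} (hn : 0 < n) :
    G.IsCycleList (List.iterate G.nextArrow a n ++ l) ↔ n + l.length = G.period a ∧
      l = List.iterate G.nextArrow (G.nextArrow^[n] a) l.length := by
  constructor
  · rintro ⟨b, hb⟩
    exact (G.eq_of_iterate_append hn hb).2
  · rintro ⟨h1, h2⟩
    refine ⟨a, ?_⟩
    rw [← h1, List.iterate_add, ← h2]

theorem isCycleList_iterate_iff {a : G.ArrowIndex} {n : ℕ} (hn : 0 < n) :
    G.IsCycleList (List.iterate G.nextArrow a n) ↔ n = G.period a := by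
  have := G.isCycleList_append_iff (a := a) (l := []) hn
  simpa using this

/-- Consecutive arrows of a cycle follow each other. -/
theorem IsCycleList.eq_nextArrow {G : BrauerGraph V E} {a b : G.ArrowIndex}
    {l : List G.ArrowIndex} (h : G.IsCycleList (a :: b :: l)) : b = G.nextArrow a := by
  have := (G.isCycleList_append_iff (a := a) (n := 1) (l := b :: l) one_pos).1 h
  exact (List.cons.inj this.2).1

end

end BrauerGraph

/-! ### The trace form on the path algebra of `Q_Γ` -/

namespace BrauerGraph

noncomputable section

open PathAlgebra

variable {V E : Type*} (G : BrauerGraph V E) (k : Type*) [Field k]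

/-- The trivial path at an edge. -/
def nilElt (i : G.QuiverVertex) : PathAlgebra k G.QuiverVertex :=
  ofPath k (Quiver.Path.nil : Quiver.Path i i)

/-- The path of length `n` that follows the cyclic ordering, starting with the arrow `a`. -/
def walkPath (a : G.ArrowIndex) : (n : ℕ) → Quiver.Path (G.src a) (G.src (G.nextArrow^[n] a))
  | 0 => .nil
  | n + 1 => (walkPath a n).cons
      ⟨G.nextArrow^[n] a, rfl, by rw [Function.iterate_succ_apply']; rfl⟩

theorem arrowList_walkPath (a : G.ArrowIndex) (n : ℕ) :
    G.arrowList (G.walkPath a n) = List.iterate G.nextArrow a n := by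
  induction n with
  | zero => rfl
  | succ n ih => rw [walkPath, arrowList, ih, iterate_succ_last]

/-- The path of length `n` that follows the cyclic ordering, starting with the arrow `a`. -/
def walkElt (a : G.ArrowIndex) (n : ℕ) : PathAlgebra k G.QuiverVertex :=
  ofPath k (G.walkPath a n)

open Classical in
/-- The linear form that takes the value one on the cycles, and zero on all other paths. -/
def trace : PathAlgebra k G.QuiverVertex →ₗ[k] k :=
  (basis k G.QuiverVertex).constr k fun p => if G.IsCycleList (G.arrowList p.2.2) then 1 else 0

variable {k}

theorem trace_ofPath_of_isCycleList {i j : G.QuiverVertex} {p : Quiver.Path i j}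
    (h : G.IsCycleList (G.arrowList p)) : G.trace k (ofPath k p) = 1 := by
  rw [trace, ofPath, Module.Basis.constr_basis, if_pos h]

theorem trace_ofPath_of_not_isCycleList {i j : G.QuiverVertex} {p : Quiver.Path i j}
    (h : ¬ G.IsCycleList (G.arrowList p)) : G.trace k (ofPath k p) = 0 := by
  rw [trace, ofPath, Module.Basis.constr_basis, if_neg h]

theorem ofPath_mul_eq {i j i' j' : G.QuiverVertex} (p : Quiver.Path i j) (q : Quiver.Path i' j') :
    ofPath k p * ofPath k q = 0 ∨ ∃ r : Quiver.Path i j', ofPath k p * ofPath k q = ofPath k r ∧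
      G.arrowList r = G.arrowList p ++ G.arrowList q := by
  by_cases h : j = i'
  · subst h
    exact .inr ⟨p.comp q, ofPath_mul_ofPath p q, G.arrowList_comp p q⟩
  · exact .inl (ofPath_mul_ofPath_of_ne p q h)

theorem trace_mul_of_not_isCycleList {i j i' j' : G.QuiverVertex} {p : Quiver.Path i j}
    {q : Quiver.Path i' j'} (h : ¬ G.IsCycleList (G.arrowList p ++ G.arrowList q)) :
    G.trace k (ofPath k p * ofPath k q) = 0 := by
  obtain h0 | ⟨r, hr, hl⟩ := G.ofPath_mul_eq (k := k) p q
  · rw [h0, map_zero]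
  · rw [hr]
    exact G.trace_ofPath_of_not_isCycleList (by rwa [hl])

theorem nilElt_mul_self (i : G.QuiverVertex) :
    G.nilElt k i * G.nilElt k i = G.nilElt k i := by
  rw [nilElt, ofPath_mul_ofPath, Quiver.Path.comp_nil]

theorem nilElt_mul_of_ne {i j : G.QuiverVertex} (h : i ≠ j) :
    G.nilElt k i * G.nilElt k j = 0 :=
  ofPath_mul_ofPath_of_ne _ _ h

theorem trace_nilElt [Finite E] (i : G.QuiverVertex) : G.trace k (G.nilElt k i) = 0 := by
  apply trace_ofPath_of_not_isCycleList
  rintro ⟨a, ha⟩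
  have := congrArg List.length ha
  rw [List.length_iterate] at this
  exact (G.period_pos a).ne this

theorem trace_mul_comm [Finite E] (x y : PathAlgebra k G.QuiverVertex) :
    G.trace k (x * y) = G.trace k (y * x) := by
  classical
  induction x using induction_on with
  | zero => rw [mul_def, mul_def]; simp
  | add x x' hx hx' => rw [add_mul', mul_add', map_add, map_add, hx, hx']
  | smul c i j p =>
  induction y using induction_on with
  | zero => rw [mul_def, mul_def]; simp
  | add x x' hx hx' => rw [add_mul', mul_add', map_add, map_add, hx, hx']
  | smul d i' j' q =>
  simp only [PathAlgebra.smul_mul', PathAlgebra.mul_smul', map_smul]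
  rw [smul_comm]
  congr 2
  -- Being a cycle list does not depend on the order of the factors. It remains to match
  -- composability, which the lists do not see when one of the paths is trivial; it follows because
  -- a full cycle ends where it starts.
  by_cases hc : G.IsCycleList (G.arrowList p ++ G.arrowList q)
  · by_cases h : j = i'
    · subst h
      have hc' : G.IsCycleList (G.arrowList (p.comp q)) := by rwa [arrowList_comp]
      obtain ⟨a, ha⟩ := hc'
      have := G.endpoints_of_arrowList _ (G.period_pos a) ha
      rw [iterate_period] at this
      obtain rfl : i = j' := this.1.trans this.2.symm
      rw [ofPath_mul_ofPath, ofPath_mul_ofPath,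
        trace_ofPath_of_isCycleList _ (by rwa [arrowList_comp]),
        trace_ofPath_of_isCycleList _ (by rw [arrowList_comp]; exact hc.rotate)]
    · rw [ofPath_mul_ofPath_of_ne _ _ h, map_zero]
      by_cases h' : j' = i
      · subst h'
        have hc' : G.IsCycleList (G.arrowList (q.comp p)) := by
          rw [arrowList_comp]; exact hc.rotate
        obtain ⟨a, ha⟩ := hc'
        have := G.endpoints_of_arrowList _ (G.period_pos a) ha
        rw [iterate_period] at this
        exact absurd (this.2.trans this.1.symm) h
      · rw [ofPath_mul_ofPath_of_ne _ _ h', map_zero]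
  · rw [trace_mul_of_not_isCycleList _ hc,
      trace_mul_of_not_isCycleList _ fun h => hc h.rotate]

theorem trace_walkElt {a : G.ArrowIndex} {n : ℕ} (hn : 0 < n) [Decidable (n = G.period a)] :
    G.trace k (G.walkElt k a n) = if n = G.period a then 1 else 0 := by
  split_ifs with h
  · apply trace_ofPath_of_isCycleList
    rw [arrowList_walkPath, h]
    exact ⟨a, rfl⟩
  · apply trace_ofPath_of_not_isCycleList
    rwa [arrowList_walkPath, isCycleList_iterate_iff _ hn]

variable [Fintype E]

omit [Fintype E] in
theorem ofPath_toPath {i j : G.QuiverVertex} (f : i ⟶ j) :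
    ofPath k f.toPath = G.arrowElt k f.1 := by
  obtain ⟨a, rfl, rfl⟩ := f
  rfl

omit [Fintype E] in
theorem nilElt_mul_arrowElt (a : G.ArrowIndex) :
    G.nilElt k (G.src a) * G.arrowElt k a = G.arrowElt k a := by
  rw [nilElt, arrowElt, ofPath_mul_ofPath, Quiver.Path.nil_comp]

theorem nilElt_mul_arrowElt_of_ne {i : G.QuiverVertex} {a : G.ArrowIndex} (h : i ≠ G.src a) :
    G.nilElt k i * G.arrowElt k a = 0 :=
  ofPath_mul_ofPath_of_ne _ _ h

omit [Fintype E] in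
theorem arrowElt_mul_nilElt (a : G.ArrowIndex) :
    G.arrowElt k a * G.nilElt k (G.tgt a) = G.arrowElt k a := by
  rw [nilElt, arrowElt, ofPath_mul_ofPath, Quiver.Path.comp_nil]

theorem arrowElt_mul_of_ne {a b : G.ArrowIndex} (h : G.tgt a ≠ G.src b) :
    G.arrowElt k a * G.arrowElt k b = 0 :=
  ofPath_mul_ofPath_of_ne _ _ h

omit [Fintype E] in
theorem walkElt_zero (a : G.ArrowIndex) : G.walkElt k a 0 = G.nilElt k (G.src a) := rfl

omit [Fintype E] in
theorem walkElt_succ (a : G.ArrowIndex) (n : ℕ) :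
    G.walkElt k a (n + 1) = G.walkElt k a n * G.arrowElt k (G.nextArrow^[n] a) := by
  rw [walkElt, walkPath, ofPath_cons, ofPath_toPath, walkElt]

omit [Fintype E] in
theorem walkElt_one (a : G.ArrowIndex) : G.walkElt k a 1 = G.arrowElt k a := by
  rw [walkElt_succ, walkElt_zero, Function.iterate_zero_apply, nilElt_mul_arrowElt]

omit [Fintype E] in
theorem walkElt_mul_nilElt (a : G.ArrowIndex) (n : ℕ) :
    G.walkElt k a n * G.nilElt k (G.src (G.nextArrow^[n] a)) = G.walkElt k a n := by
  rw [nilElt, walkElt, ofPath_mul_ofPath, Quiver.Path.comp_nil]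

theorem walkElt_mul_walkElt (a : G.ArrowIndex) (m n : ℕ) :
    G.walkElt k a m * G.walkElt k (G.nextArrow^[m] a) n = G.walkElt k a (m + n) := by
  induction n with
  | zero => rw [walkElt_zero, walkElt_mul_nilElt, add_zero]
  | succ n ih =>
    rw [walkElt_succ, ← mul_assoc, ih, ← add_assoc, walkElt_succ, ← Function.iterate_add_apply,
      add_comm n m]

theorem cycle_eq_walkElt (a : G.ArrowIndex) : G.cycle k a = G.walkElt k a (G.period a) := by
  have key : ∀ n, ((List.range (n + 1)).map fun n => G.arrowElt k (G.nextArrow^[n] a)).prod =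
      G.walkElt k a (n + 1) := by
    intro n
    induction n with
    | zero => simp [walkElt_one]
    | succ n ih =>
      rw [List.range_succ, List.map_append, List.prod_append, ih, walkElt_succ _ _ (n + 1)]
      simp
  obtain ⟨n, hn⟩ := Nat.exists_eq_add_one.2 (G.period_pos a)
  rw [cycle, hn, ← key, ← hn]
  rfl

theorem cyclePow_eq_walkElt (hmult : ∀ ν : V, G.mult ν = 1) (a : G.ArrowIndex) :
    G.cyclePow k a = G.walkElt k a (G.period a) := by
  rw [cyclePow, hmult, pow_one, cycle_eq_walkElt]

theorem trace_walkElt_mul_nilElt {a : G.ArrowIndex} {n : ℕ} {i : G.QuiverVertex} (hn : 0 < n)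
    [Decidable (n = G.period a ∧ G.src a = i)] :
    G.trace k (G.walkElt k a n * G.nilElt k i) =
      if n = G.period a ∧ G.src a = i then 1 else 0 := by
  classical
  by_cases hi : G.src (G.nextArrow^[n] a) = i
  · subst hi
    rw [walkElt_mul_nilElt, trace_walkElt _ hn]
    refine if_congr ⟨fun h => ⟨h, ?_⟩, And.left⟩ rfl rfl
    rw [h, iterate_period]
  · rw [walkElt, nilElt, ofPath_mul_ofPath_of_ne _ _ hi, map_zero, if_neg]
    rintro ⟨rfl, h⟩
    rw [iterate_period] at hi
    exact hi h

theorem trace_walkElt_mul_walkElt {a b : G.ArrowIndex} {m n : ℕ} (hm : 0 < m) (hn : 0 < n)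
    [Decidable (m + n = G.period a ∧ b = G.nextArrow^[m] a)] :
    G.trace k (G.walkElt k a m * G.walkElt k b n) =
      if m + n = G.period a ∧ b = G.nextArrow^[m] a then 1 else 0 := by
  classical
  split_ifs with h
  · rw [h.2, walkElt_mul_walkElt, trace_walkElt _ (by lia), if_pos h.1]
  · apply trace_mul_of_not_isCycleList
    rw [arrowList_walkPath, arrowList_walkPath, isCycleList_append_iff _ hm, List.length_iterate]
    rintro ⟨h1, h2⟩
    refine h ⟨h1, ?_⟩
    obtain ⟨n, rfl⟩ := Nat.exists_eq_add_one.2 hn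
    exact (List.cons.inj h2).1

theorem trace_eq_zero_of_forall_path {x : PathAlgebra k G.QuiverVertex}
    (h : ∀ (i j : G.QuiverVertex) (p : Quiver.Path i j), G.trace k (x * ofPath k p) = 0)
    (y : PathAlgebra k G.QuiverVertex) : G.trace k (x * y) = 0 := by
  induction y using induction_on with
  | zero => simp
  | add y y' hy hy' => rw [mul_add, map_add, hy, hy', add_zero]
  | smul c i j p => rw [mul_smul_comm, map_smul, h, smul_zero]

theorem trace_cycle_mul_cons (a : G.ArrowIndex) {i j : G.QuiverVertex} (p : Quiver.Path i j)
    (hp : G.arrowList p ≠ []) : G.trace k (G.walkElt k a (G.period a) * ofPath k p) = 0 := by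
  apply trace_mul_of_not_isCycleList
  rw [arrowList_walkPath, isCycleList_append_iff _ (G.period_pos a)]
  rintro ⟨h, -⟩
  exact hp (List.length_eq_zero_iff.1 (by lia))

/-- A path following a full cycle can contribute only if it is trivial, and two cycles starting at
the same edge then contribute equally. In the second relation the path is longer than a cycle, and
in the third two consecutive arrows do not follow each other. -/
theorem trace_relation_mul (hmult : ∀ ν : V, G.mult ν = 1) {x : PathAlgebra k G.QuiverVertex}
    (hx : G.Relation k x) (y : PathAlgebra k G.QuiverVertex) : G.trace k (x * y) = 0 := by
  classical
  refine G.trace_eq_zero_of_forall_path (fun i j p => ?_) y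
  cases hx with
  | comm a b hedge hne =>
    rw [cyclePow_eq_walkElt _ hmult, cyclePow_eq_walkElt _ hmult, sub_mul, map_sub]
    cases p with
    | nil =>
      change G.trace k (_ * G.nilElt k i) - G.trace k (_ * G.nilElt k i) = 0
      rw [trace_walkElt_mul_nilElt _ (G.period_pos a), trace_walkElt_mul_nilElt _ (G.period_pos b),
        hedge]
      simp
    | cons p f =>
      rw [trace_cycle_mul_cons, trace_cycle_mul_cons, sub_zero] <;> simp [arrowList]
  | trunc a ha =>
    rw [cyclePow_eq_walkElt _ hmult, mul_assoc, arrowElt]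
    obtain h | ⟨r, hr, hl⟩ := G.ofPath_mul_eq (k := k) (G.arrow a).toPath p
    · rw [h, mul_zero, map_zero]
    · rw [hr]
      exact G.trace_cycle_mul_cons a r (by rw [hl]; simp [Quiver.Hom.toPath, arrowList])
  | zero a b hcomp hne =>
    rw [mul_assoc, arrowElt, arrowElt]
    obtain h | ⟨r, hr, hl⟩ := G.ofPath_mul_eq (k := k) (G.arrow b).toPath p
    · rw [h, mul_zero, map_zero]
    · rw [hr]
      apply trace_mul_of_not_isCycleList
      rw [hl]
      simp only [Quiver.Hom.toPath, arrowList, List.nil_append, List.cons_append]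
      exact fun h => hne h.eq_nextArrow

end

end BrauerGraph

/-! ### The cut quiver, its walks and their complements -/

namespace BrauerGraph

noncomputable section

open PathAlgebra

variable {V E : Type*} (G : BrauerGraph V E) (D : Set G.ArrowIndex)

/-- The vertex set of the quiver that arises from `Q_Γ` by deleting the arrows in `D`. -/
def CutVertex (_ : Set G.ArrowIndex) := E

instance [Fintype E] : Fintype (G.CutVertex D) := inferInstanceAs (Fintype E)

/-- A vertex of `Q_Γ`, as a vertex of the cut quiver. -/
def toCut (i : G.QuiverVertex) : G.CutVertex D := i

/-- A vertex of the cut quiver, as a vertex of `Q_Γ`. -/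
def ofCut (i : G.CutVertex D) : G.QuiverVertex := i

/-- The quiver that arises from `Q_Γ` by deleting the arrows in `D`. -/
instance : Quiver (G.CutVertex D) where
  Hom i j := {a : G.ArrowIndex // a ∉ D ∧ G.toCut D (G.src a) = i ∧ G.toCut D (G.tgt a) = j}

/-- An arrow outside `D`, in the cut quiver. -/
def cutArrow (a : G.ArrowIndex) (h : a ∉ D) : G.toCut D (G.src a) ⟶ G.toCut D (G.tgt a) :=
  ⟨a, h, rfl, rfl⟩

variable (k : Type*) [Field k] [Fintype E]

/-- The trivial path at a vertex of the cut quiver. -/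
def cutNilElt (i : G.QuiverVertex) : PathAlgebra k (G.CutVertex D) :=
  ofPath k (Quiver.Path.nil : Quiver.Path (G.toCut D i) (G.toCut D i))

open Classical in
/-- The arrow attached to a half-edge in the path algebra of the cut quiver; zero if the arrow has
been deleted. -/
def cutArrowElt (a : G.ArrowIndex) : PathAlgebra k (G.CutVertex D) :=
  if h : a ∈ D then 0 else ofPath k (G.cutArrow D a h).toPath

/-- The ideal of the path algebra of the cut quiver generated by the products of two arrows which
do not follow each other in the cyclic ordering. -/
def cutIdeal : TwoSidedIdeal (PathAlgebra k (G.CutVertex D)) :=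
  TwoSidedIdeal.span {x | ∃ (i j l : G.CutVertex D) (f : i ⟶ j) (g : j ⟶ l),
    g.1 ≠ G.nextArrow f.1 ∧ x = ofPath k (f.toPath.comp g.toPath)}

variable {k D}

theorem cutArrowElt_of_mem {a : G.ArrowIndex} (h : a ∈ D) : G.cutArrowElt D k a = 0 := by
  rw [cutArrowElt, dif_pos h]

theorem cutOfPath_toPath {i j : G.CutVertex D} (f : i ⟶ j) :
    ofPath k f.toPath = G.cutArrowElt D k f.1 := by
  obtain ⟨a, h, rfl, rfl⟩ := f
  rw [cutArrowElt, dif_neg h]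
  rfl

omit [Fintype E] in
theorem cutNilElt_mul_self (i : G.QuiverVertex) :
    G.cutNilElt D k i * G.cutNilElt D k i = G.cutNilElt D k i := by
  rw [cutNilElt, ofPath_mul_ofPath, Quiver.Path.comp_nil]

theorem cutNilElt_mul_cutArrowElt (a : G.ArrowIndex) :
    G.cutNilElt D k (G.src a) * G.cutArrowElt D k a = G.cutArrowElt D k a := by
  rw [cutArrowElt]
  split_ifs with h
  · rw [mul_zero]
  · rw [cutNilElt, ofPath_mul_ofPath, Quiver.Path.nil_comp]

theorem cutArrowElt_mul_cutNilElt (a : G.ArrowIndex) :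
    G.cutArrowElt D k a * G.cutNilElt D k (G.tgt a) = G.cutArrowElt D k a := by
  rw [cutArrowElt]
  split_ifs with h
  · rw [zero_mul]
  · rw [cutNilElt, ofPath_mul_ofPath, Quiver.Path.comp_nil]

theorem cutArrowElt_mul_mem {a b : G.ArrowIndex} (h : G.tgt a = G.src b)
    (hne : b ≠ G.nextArrow a) :
    G.cutArrowElt D k a * G.cutArrowElt D k b ∈ G.cutIdeal D k := by
  by_cases ha : a ∈ D
  · rw [cutArrowElt_of_mem _ ha, zero_mul]
    exact zero_mem _
  by_cases hb : b ∈ D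
  · rw [cutArrowElt_of_mem _ hb, mul_zero]
    exact zero_mem _
  let g : G.toCut D (G.tgt a) ⟶ G.toCut D (G.tgt b) := ⟨b, hb, h ▸ rfl, rfl⟩
  refine TwoSidedIdeal.subset_span ⟨_, _, _, G.cutArrow D a ha, g, hne, ?_⟩
  rw [← ofPath_mul_ofPath, cutOfPath_toPath, cutOfPath_toPath]
  rfl

variable (k D) in
/-- The inclusion of the path algebra of the cut quiver. -/
def cutInclusion : PathAlgebra k (G.CutVertex D) →ₐ[k] PathAlgebra k G.QuiverVertex :=
  LiftData.lift k
    { idem := fun i => G.nilElt k (G.ofCut D i)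
      arr := fun f => G.arrowElt k f.1
      idem_mul_idem := fun i => G.nilElt_mul_self _
      idem_mul_of_ne := fun i j h => G.nilElt_mul_of_ne h
      sum_idem := (one_def (k := k) (Q := G.QuiverVertex)).symm
      idem_mul_arr := fun f => by
        obtain ⟨a, h, rfl, rfl⟩ := f
        exact G.nilElt_mul_arrowElt a
      arr_mul_idem := fun f => by
        obtain ⟨a, h, rfl, rfl⟩ := f
        exact G.arrowElt_mul_nilElt a }

theorem cutInclusion_nilElt (i : G.QuiverVertex) :
    G.cutInclusion D k (G.cutNilElt D k i) = G.nilElt k i :=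
  LiftData.lift_nil _ (G.toCut D i)

theorem cutInclusion_arrowElt {a : G.ArrowIndex} (h : a ∉ D) :
    G.cutInclusion D k (G.cutArrowElt D k a) = G.arrowElt k a := by
  rw [cutArrowElt, dif_neg h]
  exact LiftData.lift_arrow _ _

variable (k D) in
/-- The projection of the path algebra onto that of the cut quiver. -/
def cutProjection : PathAlgebra k G.QuiverVertex →ₐ[k] PathAlgebra k (G.CutVertex D) :=
  LiftData.lift k
    { idem := fun i => G.cutNilElt D k i
      arr := fun f => G.cutArrowElt D k f.1
      idem_mul_idem := fun i => G.cutNilElt_mul_self i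
      idem_mul_of_ne := fun i j h => ofPath_mul_ofPath_of_ne _ _ h
      sum_idem := (one_def (k := k) (Q := G.CutVertex D)).symm
      idem_mul_arr := fun f => by
        obtain ⟨a, rfl, rfl⟩ := f
        exact G.cutNilElt_mul_cutArrowElt a
      arr_mul_idem := fun f => by
        obtain ⟨a, rfl, rfl⟩ := f
        exact G.cutArrowElt_mul_cutNilElt a }

theorem cutProjection_nilElt (i : G.QuiverVertex) :
    G.cutProjection D k (G.nilElt k i) = G.cutNilElt D k i :=
  LiftData.lift_nil _ i

theorem cutProjection_arrowElt (a : G.ArrowIndex) :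
    G.cutProjection D k (G.arrowElt k a) = G.cutArrowElt D k a :=
  LiftData.lift_arrow _ (G.arrow a)

theorem cutProjection_cutInclusion (x : PathAlgebra k (G.CutVertex D)) :
    G.cutProjection D k (G.cutInclusion D k x) = x := by
  suffices h : (G.cutProjection D k).comp (G.cutInclusion D k) = AlgHom.id k _ from
    DFunLike.congr_fun h x
  refine algHom_ext (fun i => ?_) (fun i j f => ?_)
  · change G.cutProjection D k (G.cutInclusion D k (G.cutNilElt D k (G.ofCut D i))) =
      G.cutNilElt D k (G.ofCut D i)
    rw [cutInclusion_nilElt, cutProjection_nilElt]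
  · rw [cutOfPath_toPath, AlgHom.comp_apply, cutInclusion_arrowElt _ f.2.1,
      cutProjection_arrowElt, AlgHom.id_apply]

theorem cutProjection_walkElt_of_mem {a : G.ArrowIndex} {n : ℕ}
    (h : ∃ m < n, G.nextArrow^[m] a ∈ D) : G.cutProjection D k (G.walkElt k a n) = 0 := by
  obtain ⟨m, hm, hmD⟩ := h
  obtain ⟨l, rfl⟩ := Nat.exists_eq_add_of_lt hm
  rw [add_right_comm, ← walkElt_mul_walkElt, walkElt_succ, map_mul, map_mul,
    cutProjection_arrowElt, G.cutArrowElt_of_mem hmD, mul_zero, zero_mul]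

theorem cutInclusion_cutProjection_walkElt {a : G.ArrowIndex} {n : ℕ}
    (h : ∀ m < n, G.nextArrow^[m] a ∉ D) :
    G.cutInclusion D k (G.cutProjection D k (G.walkElt k a n)) = G.walkElt k a n := by
  induction n with
  | zero => rw [walkElt_zero, cutProjection_nilElt, cutInclusion_nilElt]
  | succ n ih =>
    rw [walkElt_succ, map_mul, map_mul, ih fun m hm => h m (by lia), cutProjection_arrowElt,
      cutInclusion_arrowElt _ (h n (by lia))]

variable (D) in
/-- The paths of positive length in the cut quiver that follow the cyclic ordering. -/
abbrev CutWalk := {p : G.ArrowIndex × ℕ // 0 < p.2 ∧ ∀ m < p.2, G.nextArrow^[m] p.1 ∉ D}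

theorem finite_cutWalk (hD : G.IsAdmissibleCut D) : Finite (G.CutWalk D) := by
  refine Finite.of_injective
    (β := G.ArrowIndex × Fin (Nat.card (E × Bool)))
    (fun p => (p.1.1, ⟨p.1.2, (hD.lt_period p.2.2).trans_le (G.period_le_card _)⟩)) ?_
  rintro ⟨⟨a, m⟩, h⟩ ⟨⟨b, n⟩, h'⟩ hp
  simpa using hp

variable (k D) in
/-- The paths in the cut quiver that follow the cyclic ordering. -/
def cutFamily : G.QuiverVertex ⊕ G.CutWalk D → PathAlgebra k G.QuiverVertex :=
  Sum.elim (G.nilElt k) fun p => G.walkElt k p.1.1 p.1.2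

variable (k D) in
/-- The complements of the paths in the cut quiver with respect to the cycles. -/
def dualFamily (σ : G.QuiverVertex → G.ArrowIndex) :
    G.QuiverVertex ⊕ G.CutWalk D → PathAlgebra k G.QuiverVertex :=
  Sum.elim (fun i => G.walkElt k (σ i) (G.period (σ i)))
    fun p => G.walkElt k (G.nextArrow^[p.1.2] p.1.1) (G.period p.1.1 - p.1.2)

section Family

variable (hD : G.IsAdmissibleCut D) (σ : G.QuiverVertex → G.ArrowIndex)

theorem cutInclusion_cutProjection_cutFamily (x : G.QuiverVertex ⊕ G.CutWalk D) :
    G.cutInclusion D k (G.cutProjection D k (G.cutFamily D k x)) = G.cutFamily D k x := by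
  obtain i | p := x
  · change G.cutInclusion D k (G.cutProjection D k (G.nilElt k i)) = G.nilElt k i
    rw [cutProjection_nilElt, cutInclusion_nilElt]
  · exact G.cutInclusion_cutProjection_walkElt p.2.2

include hD

omit [Fintype E] in
theorem dualFamily_eq_walkElt [Finite E] (x : G.QuiverVertex ⊕ G.CutWalk D) :
    ∃ a n, 0 < n ∧ n ≤ G.period a ∧ (∃ m < n, G.nextArrow^[m] a ∈ D) ∧
      G.dualFamily D k σ x = G.walkElt k a n := by
  obtain i | ⟨⟨a, n⟩, hn, h⟩ := x
  · obtain ⟨m, hm, -⟩ := hD (σ i)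
    exact ⟨σ i, _, G.period_pos _, le_rfl, ⟨m, hm⟩, rfl⟩
  · have := hD.lt_period h
    exact ⟨_, _, Nat.sub_pos_of_lt this, by rw [period_iterate]; exact Nat.sub_le _ _,
      hD.exists_mem_complement h, rfl⟩

theorem cutProjection_dualFamily (x : G.QuiverVertex ⊕ G.CutWalk D) :
    G.cutProjection D k (G.dualFamily D k σ x) = 0 := by
  obtain ⟨a, n, -, -, h, hx⟩ := G.dualFamily_eq_walkElt (k := k) hD σ x
  rw [hx, G.cutProjection_walkElt_of_mem h]

omit [Fintype E] in
theorem trace_cutFamily [Finite E] (x : G.QuiverVertex ⊕ G.CutWalk D) :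
    G.trace k (G.cutFamily D k x) = 0 := by
  classical
  obtain i | ⟨⟨a, n⟩, hn, h⟩ := x
  · exact G.trace_nilElt i
  · exact (G.trace_walkElt hn).trans (if_neg (hD.lt_period h).ne)

/-- Each factor contains an arrow of `D`. If the product were a full cycle, these two arrows would
sit at different positions of it, against the uniqueness in the cut. -/
theorem trace_dualFamily_mul (x y : G.QuiverVertex ⊕ G.CutWalk D) :
    G.trace k (G.dualFamily D k σ x * G.dualFamily D k σ y) = 0 := by
  classical
  obtain ⟨a, n, hn, hna, ⟨m, hm, hmD⟩, hx⟩ := G.dualFamily_eq_walkElt (k := k) hD σ x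
  obtain ⟨b, n', hn', hnb, ⟨m', hm', hmD'⟩, hy⟩ := G.dualFamily_eq_walkElt (k := k) hD σ y
  rw [hx, hy, trace_walkElt_mul_walkElt _ hn hn', if_neg]
  rintro ⟨h, rfl⟩
  rw [← Function.iterate_add_apply] at hmD'
  have := hD.eq_of_mem (by lia) (by lia) hmD hmD'
  lia

/-- The complement of a walk closes up to a full cycle only with that walk: the length and the first
arrow of the missing piece are both forced. A full cycle closes up only with the trivial path at its
source. -/
theorem trace_dualFamily_mul_cutFamily (hσ : ∀ i, G.src (σ i) = i)
    [DecidableEq (G.QuiverVertex ⊕ G.CutWalk D)]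
    (x y : G.QuiverVertex ⊕ G.CutWalk D) :
    G.trace k (G.dualFamily D k σ x * G.cutFamily D k y) = if x = y then 1 else 0 := by
  classical
  obtain i | ⟨⟨a, n⟩, hn, h⟩ := x <;> obtain j | ⟨⟨b, m⟩, hm, h'⟩ := y
  · change G.trace k (G.walkElt k (σ i) (G.period (σ i)) * G.nilElt k j) = _
    rw [trace_walkElt_mul_nilElt _ (G.period_pos _), hσ]
    exact if_congr (by simp) rfl rfl
  · change G.trace k (G.walkElt k (σ i) (G.period (σ i)) * G.walkElt k b m) = _
    rw [trace_walkElt_mul_walkElt _ (G.period_pos _) hm, if_neg, if_neg Sum.inl_ne_inr]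
    dsimp only at hm
    lia
  · have := hD.lt_period h
    dsimp only at hn this
    change G.trace k (G.walkElt k (G.nextArrow^[n] a) (G.period a - n) * G.nilElt k j) = _
    rw [trace_walkElt_mul_nilElt _ (Nat.sub_pos_of_lt this), if_neg, if_neg Sum.inr_ne_inl]
    rw [period_iterate]
    lia
  · have := hD.lt_period h
    dsimp only at hn hm this
    change G.trace k (G.walkElt k (G.nextArrow^[n] a) (G.period a - n) * G.walkElt k b m) = _
    rw [trace_walkElt_mul_walkElt _ (by lia) hm, period_iterate, ← Function.iterate_add_apply,
      Nat.sub_add_cancel this.le, iterate_period]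
    refine if_congr ?_ rfl rfl
    simp only [Sum.inr.injEq, Subtype.mk.injEq, Prod.mk.injEq]
    constructor
    · rintro ⟨h1, rfl⟩
      exact ⟨rfl, by lia⟩
    · rintro ⟨rfl, rfl⟩
      exact ⟨by lia, rfl⟩

end Family

end

end BrauerGraph

/-! ### The isomorphism of `B_Γ` with the trivial extension of the cut algebra -/

namespace BrauerGraph

noncomputable section

open PathAlgebra BoundQuiverAlgebra

variable {V E : Type*} (G : BrauerGraph V E) {D : Set G.ArrowIndex} {k : Type*} [Field k]
  [Fintype E]

theorem toQuot_relation {x : PathAlgebra k G.QuiverVertex} (hx : G.Relation k x) :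
    toQuot (G.relIdeal k) x = 0 :=
  (toQuot_eq_zero_iff _).2 (TwoSidedIdeal.subset_span hx)

/-- The generators of the cut ideal are among the zero relations of the Brauer graph algebra. -/
theorem exists_cutSection : ∃ s : BoundQuiverAlgebra k (G.cutIdeal D k) →ₐ[k]
    BrauerGraphAlgebra k G, ∀ x, s (toQuot _ x) = toQuot _ (G.cutInclusion D k x) := by
  refine exists_lift_of_span (G.cutIdeal D k) rfl
    ((toQuot (G.relIdeal k)).comp (G.cutInclusion D k)) ?_
  rintro _ ⟨i, j, l, f, g, hne, rfl⟩
  rw [← ofPath_mul_ofPath, cutOfPath_toPath, cutOfPath_toPath, AlgHom.comp_apply, map_mul,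
    cutInclusion_arrowElt _ f.2.1, cutInclusion_arrowElt _ g.2.1]
  exact G.toQuot_relation (.zero f.1 g.1 (f.2.2.2.trans g.2.2.1.symm) hne)

/-- Every full cycle meets `D`, so each cycle occurring in the first two types of relations is sent
to zero separately; a zero relation lands in the cut ideal. -/
theorem exists_cutQuotient (hD : G.IsAdmissibleCut D) (hmult : ∀ ν : V, G.mult ν = 1) :
    ∃ π : BrauerGraphAlgebra k G →ₐ[k] BoundQuiverAlgebra k (G.cutIdeal D k),
      ∀ x, π (toQuot _ x) = toQuot _ (G.cutProjection D k x) := by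
  have hcycle : ∀ a, G.cutProjection D k (G.walkElt k a (G.period a)) = 0 := fun a =>
    G.cutProjection_walkElt_of_mem (hD a).exists
  refine exists_lift_of_span (G.relIdeal k) rfl
    ((toQuot (G.cutIdeal D k)).comp (G.cutProjection D k)) fun x hx => ?_
  rw [AlgHom.comp_apply]
  cases hx with
  | comm a b hedge hne =>
    rw [cyclePow_eq_walkElt _ hmult, cyclePow_eq_walkElt _ hmult, map_sub, hcycle, hcycle,
      sub_zero, map_zero]
  | trunc a ha => rw [cyclePow_eq_walkElt _ hmult, map_mul, hcycle, zero_mul, map_zero]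
  | zero a b hcomp hne =>
    rw [map_mul, cutProjection_arrowElt, cutProjection_arrowElt, toQuot_eq_zero_iff]
    exact G.cutArrowElt_mul_mem hcomp hne

theorem exists_trace (hmult : ∀ ν : V, G.mult ν = 1) :
    ∃ t : BrauerGraphAlgebra k G →ₗ[k] k, (∀ x y, t (x * y) = t (y * x)) ∧
      ∀ x, t (toQuot _ x) = G.trace k x :=
  exists_trace_of_span (G.relIdeal k) rfl (G.trace k) G.trace_mul_comm
    fun _ hx => G.trace_relation_mul hmult hx

theorem toQuot_arrowElt_mul_arrowElt {a b : G.ArrowIndex} (h : b ≠ G.nextArrow a) :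
    toQuot (G.relIdeal k) (G.arrowElt k a * G.arrowElt k b) = 0 := by
  by_cases hab : G.tgt a = G.src b
  · exact G.toQuot_relation (.zero a b hab h)
  · rw [arrowElt_mul_of_ne _ hab, map_zero]

theorem toQuot_walkElt_mul_arrowElt {a b : G.ArrowIndex} {n : ℕ} (hn : 0 < n)
    (h : b ≠ G.nextArrow^[n] a) :
    toQuot (G.relIdeal k) (G.walkElt k a n * G.arrowElt k b) = 0 := by
  obtain ⟨n, rfl⟩ := Nat.exists_eq_add_one.2 hn
  rw [walkElt_succ, mul_assoc, map_mul, toQuot_arrowElt_mul_arrowElt, mul_zero]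
  rwa [← Function.iterate_succ_apply' G.nextArrow]

theorem toQuot_walkElt_period_eq (hmult : ∀ ν : V, G.mult ν = 1) {a b : G.ArrowIndex}
    (h : G.src a = G.src b) :
    toQuot (G.relIdeal k) (G.walkElt k a (G.period a)) =
      toQuot (G.relIdeal k) (G.walkElt k b (G.period b)) := by
  by_cases hab : a = b
  · rw [hab]
  · rw [← sub_eq_zero, ← map_sub, ← cyclePow_eq_walkElt _ hmult, ← cyclePow_eq_walkElt _ hmult]
    exact G.toQuot_relation (.comm a b h hab)

/-- Only `b = a` is a problem, since `a` does follow its own cycle. If the other half-edge of the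
edge is truncated, this is a defining relation. Otherwise the cycle can be exchanged for the one
starting at the other half-edge, which `b` does not continue. -/
theorem toQuot_walkElt_period_mul_arrowElt (hmult : ∀ ν : V, G.mult ν = 1) (a b : G.ArrowIndex) :
    toQuot (G.relIdeal k) (G.walkElt k a (G.period a) * G.arrowElt k b) = 0 := by
  by_cases hab : b = a
  · subst hab
    by_cases ht : G.IsTruncated (b.1.1, !b.1.2)
    · rw [← cyclePow_eq_walkElt _ hmult]
      exact G.toQuot_relation (.trunc b ht)
    · let c : G.ArrowIndex := ⟨(b.1.1, !b.1.2), ht⟩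
      have hbc : b ≠ c := fun h => by
        have := congrArg (fun x : G.ArrowIndex => x.1.2) h
        simp [c] at this
      rw [map_mul, G.toQuot_walkElt_period_eq hmult (show G.src b = G.src c from rfl), ← map_mul]
      apply G.toQuot_walkElt_mul_arrowElt (G.period_pos c)
      rwa [iterate_period]
  · apply G.toQuot_walkElt_mul_arrowElt (G.period_pos a)
    rwa [iterate_period]

/-- Every path is, in the Brauer graph algebra, zero, trivial, or a part of a cycle. -/
theorem toQuot_ofPath (hmult : ∀ ν : V, G.mult ν = 1) {i j : G.QuiverVertex} (p : Quiver.Path i j) :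
    toQuot (G.relIdeal k) (ofPath k p) = 0 ∨
    (∃ l, toQuot (G.relIdeal k) (ofPath k p) = toQuot (G.relIdeal k) (G.nilElt k l)) ∨
    ∃ a n, 0 < n ∧ n ≤ G.period a ∧
      toQuot (G.relIdeal k) (ofPath k p) = toQuot (G.relIdeal k) (G.walkElt k a n) := by
  induction p with
  | nil => exact .inr (.inl ⟨i, rfl⟩)
  | cons p f ih =>
    rw [ofPath_cons, ofPath_toPath, map_mul]
    obtain h | ⟨l, h⟩ | ⟨a, n, hn, hna, h⟩ := ih
    · left
      rw [h, zero_mul]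
    · rw [h, ← map_mul]
      by_cases hl : l = G.src f.1
      · subst hl
        rw [nilElt_mul_arrowElt, ← walkElt_one]
        exact .inr (.inr ⟨f.1, 1, one_pos, G.period_pos _, rfl⟩)
      · rw [nilElt_mul_arrowElt_of_ne _ hl, map_zero]
        exact .inl rfl
    · rw [h, ← map_mul]
      obtain rfl | hlt := hna.eq_or_lt
      · exact .inl (G.toQuot_walkElt_period_mul_arrowElt hmult a f.1)
      by_cases hf : f.1 = G.nextArrow^[n] a
      · rw [hf, ← walkElt_succ]
        exact .inr (.inr ⟨a, n + 1, n.succ_pos, hlt, rfl⟩)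
      · exact .inl (G.toQuot_walkElt_mul_arrowElt hn hf)

theorem toQuot_walkElt_mem_family (hD : G.IsAdmissibleCut D) (hmult : ∀ ν : V, G.mult ν = 1)
    {σ : G.QuiverVertex → G.ArrowIndex} (hσ : ∀ i, G.src (σ i) = i) {a : G.ArrowIndex} {n : ℕ}
    (hn : 0 < n) (hna : n ≤ G.period a) :
    ∃ x, toQuot (G.relIdeal k) (G.walkElt k a n) = toQuot (G.relIdeal k) (G.cutFamily D k x) ∨
      toQuot (G.relIdeal k) (G.walkElt k a n) = toQuot (G.relIdeal k) (G.dualFamily D k σ x) := by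
  obtain rfl | hlt := hna.eq_or_lt
  -- The two cycles at an edge agree in the quotient, so it does not matter which one `σ` selects.
  · exact ⟨.inl (G.src a), .inr (G.toQuot_walkElt_period_eq hmult (hσ _).symm)⟩
  by_cases h : ∃ m < n, G.nextArrow^[m] a ∈ D
  · obtain ⟨m, hm, hmD⟩ := h
    -- The walk meets `D`, so the rest of its cycle avoids `D`, and the walk is the complement of
    -- that rest.
    refine ⟨.inr ⟨(G.nextArrow^[n] a, G.period a - n), Nat.sub_pos_of_lt hlt,
      hD.notMem_complement hm hmD⟩, .inr ?_⟩
    change _ = toQuot _ (G.walkElt k (G.nextArrow^[G.period a - n] (G.nextArrow^[n] a))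
      (G.period (G.nextArrow^[n] a) - (G.period a - n)))
    rw [← Function.iterate_add_apply, Nat.sub_add_cancel hna, iterate_period, period_iterate,
      Nat.sub_sub_self hna]
  · push Not at h
    exact ⟨.inr ⟨(a, n), hn, h⟩, .inl rfl⟩

/-- The cut algebra has finite dimension, and its trivial extension is the Brauer graph algebra. -/
theorem finite_and_nonempty_algEquiv (hD : G.IsAdmissibleCut D) (hmult : ∀ ν : V, G.mult ν = 1)
    {σ : G.QuiverVertex → G.ArrowIndex} (hσ : ∀ i, G.src (σ i) = i) :
    Module.Finite k (BoundQuiverAlgebra k (G.cutIdeal D k)) ∧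
      Nonempty (BrauerGraphAlgebra k G ≃ₐ[k]
        TrivialExtension k (BoundQuiverAlgebra k (G.cutIdeal D k))) := by
  classical
  obtain ⟨s, hs⟩ := G.exists_cutSection (D := D) (k := k)
  obtain ⟨π, hπ⟩ := G.exists_cutQuotient (k := k) hD hmult
  obtain ⟨t, hsymm, ht⟩ := G.exists_trace (k := k) hmult
  have := G.finite_cutWalk hD
  have : Finite G.QuiverVertex := Finite.of_fintype _
  let q := fun x => toQuot (G.cutIdeal D k) (G.cutProjection D k (G.cutFamily D k x))
  let c := fun x => toQuot (G.relIdeal k) (G.dualFamily D k σ x)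
  have hπs : ∀ a, π (s a) = a := fun a => by
    obtain ⟨x, rfl⟩ := toQuot_surjective _ a
    rw [hs, hπ, cutProjection_cutInclusion]
  have hsq : ∀ x, s (q x) = toQuot _ (G.cutFamily D k x) := fun x => by
    rw [hs, cutInclusion_cutProjection_cutFamily]
  have hπc : ∀ x, π (c x) = 0 := fun x => by
    rw [hπ, G.cutProjection_dualFamily hD, map_zero]
  have hspan : Submodule.span k (Set.range (s ∘ q) ∪ Set.range c) = ⊤ := by
    rw [eq_top_iff]
    intro b _
    obtain ⟨x, rfl⟩ := toQuot_surjective _ b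
    have hq : ∀ x, toQuot _ (G.cutFamily D k x) ∈
        Submodule.span k (Set.range (s ∘ q) ∪ Set.range c) := fun x =>
      Submodule.subset_span (.inl ⟨x, hsq x⟩)
    induction x using induction_on with
    | zero => rw [map_zero]; exact zero_mem _
    | add x y hx hy => rw [map_add]; exact add_mem (hx trivial) (hy trivial)
    | smul r i j p =>
      rw [map_smul]
      refine Submodule.smul_mem _ _ ?_
      obtain h | ⟨l, h⟩ | ⟨a, n, hn, hna, h⟩ := G.toQuot_ofPath (k := k) hmult p
      · rw [h]; exact zero_mem _
      · rw [h]; exact hq (.inl l)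
      · rw [h]
        obtain ⟨x, hx | hx⟩ := G.toQuot_walkElt_mem_family (k := k) hD hmult hσ hn hna
        · rw [hx]; exact hq x
        · rw [hx]; exact Submodule.subset_span (.inr ⟨x, rfl⟩)
  constructor
  · have h := TrivialExtension.span_range_eq_top π s hπs q c hπc hspan
    exact ⟨⟨(Set.finite_range q).toFinset, by simpa using h⟩⟩
  · refine TrivialExtension.nonempty_algEquiv_of_dualFamily π s hπs q c hπc hspan t hsymm
      (fun x => ?_) (fun x y => ?_) (fun x y => ?_)
    · rw [hsq, ht, G.trace_cutFamily hD]
    · rw [← map_mul, ht, G.trace_dualFamily_mul hD]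
    · rw [hsq, ← map_mul, ht, G.trace_dualFamily_mul_cutFamily hD σ hσ]

/-- The paths in the cut quiver that follow the cyclic ordering do not lie in the ideal. -/
theorem cutProjection_cutFamily_notMem (hD : G.IsAdmissibleCut D) (hmult : ∀ ν : V, G.mult ν = 1)
    {σ : G.QuiverVertex → G.ArrowIndex} (hσ : ∀ i, G.src (σ i) = i)
    (x : G.QuiverVertex ⊕ G.CutWalk D) :
    G.cutProjection D k (G.cutFamily D k x) ∉ G.cutIdeal D k := by
  classical
  intro h
  obtain ⟨s, hs⟩ := G.exists_cutSection (D := D) (k := k)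
  obtain ⟨t, -, ht⟩ := G.exists_trace (k := k) hmult
  have h0 := hs (G.cutProjection D k (G.cutFamily D k x))
  rw [(toQuot_eq_zero_iff _).2 h, map_zero, cutInclusion_cutProjection_cutFamily] at h0
  -- Pairing with its own complement gives one, whereas an element of the ideal would give zero.
  have h1 := ht (G.dualFamily D k σ x * G.cutFamily D k x)
  rw [map_mul, ← h0, mul_zero, map_zero, G.trace_dualFamily_mul_cutFamily hD σ hσ, if_pos rfl] at h1
  exact zero_ne_one h1

end

end BrauerGraph

/-! ### Gentleness of the cut quiver -/

namespace BrauerGraph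

noncomputable section

open PathAlgebra BoundQuiverAlgebra

variable {V E : Type*} (G : BrauerGraph V E) {D : Set G.ArrowIndex} {k : Type*} [Field k]

theorem cutSigma_ext_right {i : G.CutVertex D} {x y : Σ j : G.CutVertex D, (i ⟶ j)}
    (h : x.2.1 = y.2.1) : x = y := by
  obtain ⟨j, a, ha, hi, rfl⟩ := x
  obtain ⟨j', b, hb, hi', rfl⟩ := y
  obtain rfl : a = b := h
  rfl

theorem cutSigma_ext_left {i : G.CutVertex D} {x y : Σ j : G.CutVertex D, (j ⟶ i)}
    (h : x.2.1 = y.2.1) : x = y := by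
  obtain ⟨j, a, ha, rfl, hi⟩ := x
  obtain ⟨j', b, hb, rfl, hi'⟩ := y
  obtain rfl : a = b := h
  rfl

/-- An outgoing arrow is one of the two half-edges of the edge `i`; an incoming arrow is determined
by its successor, which is again one of these two. -/
theorem card_cutArrow_le (i : G.CutVertex D) :
    Nat.card (Σ j : G.CutVertex D, (i ⟶ j)) ≤ 2 ∧
      Nat.card (Σ j : G.CutVertex D, (j ⟶ i)) ≤ 2 := by
  constructor
  · refine (Nat.card_le_card_of_injective (β := Bool) (fun x => x.2.1.1.2) fun x y h => ?_).trans
      (by simp)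
    exact G.cutSigma_ext_right (Subtype.ext (Prod.ext (x.2.2.2.1.trans y.2.2.2.1.symm) h))
  · refine (Nat.card_le_card_of_injective (β := Bool) (fun x => (G.nextArrow x.2.1).1.2)
      fun x y h => ?_).trans (by simp)
    exact G.cutSigma_ext_left (G.nextArrow_injective
      (Subtype.ext (Prod.ext (x.2.2.2.2.trans y.2.2.2.2.symm) h)))

theorem exists_src_eq (hG : ¬ G.IsExceptional) (i : G.QuiverVertex) : ∃ a, G.src a = i := by
  rw [IsExceptional, not_or, not_exists] at hG
  by_cases h : G.IsTruncated (i, false)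
  · exact ⟨⟨(i, true), fun h' => hG.2 i ⟨h, h'⟩⟩, rfl⟩
  · exact ⟨⟨(i, false), h⟩, rfl⟩

section Connected

variable (D) in
/-- The underlying graph of the cut quiver. -/
abbrev cutGraph : SimpleGraph (G.CutVertex D) :=
  SimpleGraph.fromRel fun i j : G.CutVertex D => Nonempty (i ⟶ j)

theorem reachable_of_hom {i j : G.CutVertex D} (f : i ⟶ j) : (G.cutGraph D).Reachable i j := by
  by_cases h : i = j
  · rw [h]
  · exact SimpleGraph.Adj.reachable ((SimpleGraph.fromRel_adj _ _ _).2 ⟨h, .inl ⟨f⟩⟩)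

theorem reachable_iterate {a : G.ArrowIndex} {n : ℕ} (h : ∀ m < n, G.nextArrow^[m] a ∉ D) :
    (G.cutGraph D).Reachable (G.toCut D (G.src a)) (G.toCut D (G.src (G.nextArrow^[n] a))) := by
  induction n with
  | zero => exact .rfl
  | succ n ih =>
    refine (ih fun m hm => h m (by lia)).trans ?_
    rw [Function.iterate_succ_apply']
    exact G.reachable_of_hom (G.cutArrow D (G.nextArrow^[n] a) (h n (by lia)))

variable [Finite E] (hD : G.IsAdmissibleCut D)

include hD

/-- The endpoints of a deleted arrow stay connected through the rest of its cycle, which contains no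
other deleted arrow. -/
theorem reachable_src_tgt (a : G.ArrowIndex) :
    (G.cutGraph D).Reachable (G.toCut D (G.src a)) (G.toCut D (G.tgt a)) := by
  by_cases ha : a ∈ D
  · have h := G.reachable_iterate (hD.notMem_complement (m := 0) (n := 1) one_pos ha)
    rw [← Function.iterate_add_apply, Nat.sub_add_cancel (G.period_pos a), iterate_period] at h
    exact h.symm
  · exact G.reachable_of_hom (G.cutArrow D a ha)

theorem reachable_next (h : E × Bool) :
    (G.cutGraph D).Reachable (G.toCut D h.1) (G.toCut D (G.next h).1) := by
  by_cases ht : G.IsTruncated h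
  · have h1 := ht.1
    rw [valency_eq_minimalPeriod, Function.minimalPeriod_eq_one_iff_isFixedPt] at h1
    rw [h1]
  · exact G.reachable_src_tgt hD ⟨h, ht⟩

theorem reachable_of_vertex_eq {h h' : E × Bool}
    (hv : G.vertex h = G.vertex h') :
    (G.cutGraph D).Reachable (G.toCut D h.1) (G.toCut D h'.1) := by
  obtain ⟨n, rfl⟩ := ((G.sameCycle_iff _ _).2 hv).exists_nat_pow_eq
  rw [Equiv.Perm.coe_pow]
  clear hv
  induction n with
  | zero => exact .rfl
  | succ n ih =>
    rw [Function.iterate_succ_apply']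
    exact ih.trans (G.reachable_next hD _)

/-- Half-edges at one vertex of `Γ` lie on mutually reachable edges. A walk in `Γ` crosses an edge
by switching between its two half-edges, which does not change the vertex of the quiver. -/
theorem cutGraph_connected [Nonempty E] :
    (G.cutGraph D).Connected := by
  have key : ∀ (μ ν : V), (SimpleGraph.fromRel fun μ ν : V =>
      ∃ e : E, G.vertex (e, false) = μ ∧ G.vertex (e, true) = ν).Reachable μ ν →
      ∀ h h' : E × Bool, G.vertex h = μ → G.vertex h' = ν →
      (G.cutGraph D).Reachable (G.toCut D h.1) (G.toCut D h'.1) := by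
    rintro μ ν ⟨w⟩
    induction w with
    | nil => exact fun h h' hμ hν => G.reachable_of_vertex_eq hD (hμ.trans hν.symm)
    | cons hadj w ih =>
      intro h h' hμ hν
      rw [SimpleGraph.fromRel_adj] at hadj
      obtain ⟨-, ⟨e, h1, h2⟩ | ⟨e, h1, h2⟩⟩ := hadj
      · exact (G.reachable_of_vertex_eq hD (hμ.trans h1.symm)).trans (ih (e, true) h' h2 hν)
      · exact (G.reachable_of_vertex_eq hD (hμ.trans h2.symm)).trans (ih (e, false) h' h1 hν)
  have : Nonempty (G.CutVertex D) := ‹Nonempty E›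
  exact ⟨fun i j => key _ _ (G.connected.preconnected _ _) (i, false) (j, false) rfl rfl⟩

end Connected

variable [Fintype E]

theorem ofPath_comp_mem_cutIdeal {i j l : G.CutVertex D} {f : i ⟶ j} {g : j ⟶ l}
    (h : g.1 ≠ G.nextArrow f.1) : ofPath k (f.toPath.comp g.toPath) ∈ G.cutIdeal D k :=
  TwoSidedIdeal.subset_span ⟨i, j, l, f, g, h, rfl⟩

/-- The forward implication is the nontrivial one: two successive arrows outside `D` form a walk of
length two in `cutFamily`, which the trace pairing detects as nonzero. -/
theorem ofPath_comp_mem_cutIdeal_iff (hG : ¬ G.IsExceptional) (hD : G.IsAdmissibleCut D)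
    (hmult : ∀ ν : V, G.mult ν = 1) {i j l : G.CutVertex D} {f : i ⟶ j} {g : j ⟶ l} :
    ofPath k (f.toPath.comp g.toPath) ∈ G.cutIdeal D k ↔ g.1 ≠ G.nextArrow f.1 := by
  refine ⟨fun h hgf => ?_, G.ofPath_comp_mem_cutIdeal⟩
  choose σ hσ using G.exists_src_eq hG
  have hmem : ∀ m < 2, G.nextArrow^[m] f.1 ∉ D := by
    intro m hm
    interval_cases m
    · exact f.2.1
    · exact (congrArg (· ∉ D) hgf).mp g.2.1
  refine G.cutProjection_cutFamily_notMem (k := k) hD hmult hσ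
    (.inr ⟨(f.1, 2), two_pos, hmem⟩) ?_
  change G.cutProjection D k (G.walkElt k f.1 2) ∈ _
  rw [walkElt_succ, walkElt_one, map_mul, cutProjection_arrowElt, cutProjection_arrowElt,
    Function.iterate_one, ← hgf, ← cutOfPath_toPath, ← cutOfPath_toPath, ofPath_mul_ofPath]
  exact h

/-- Paths that do not lie in the ideal follow the cyclic ordering. -/
theorem ofPath_cons_mem_cutIdeal_or {i j : G.CutVertex D} (p : Quiver.Path i j) :
    ∀ {l : G.CutVertex D} (f : j ⟶ l), ofPath k (p.cons f) ∈ G.cutIdeal D k ∨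
      ∃ a, f.1 = G.nextArrow^[p.length] a ∧ ∀ m < p.length + 1, G.nextArrow^[m] a ∉ D := by
  induction p with
  | nil =>
    intro l f
    refine .inr ⟨f.1, rfl, fun m hm => ?_⟩
    obtain rfl : m = 0 := by simpa using hm
    exact f.2.1
  | cons p g ih =>
    intro l f
    obtain h | ⟨a, ha, hmem⟩ := ih g
    · left
      rw [ofPath_cons]
      exact TwoSidedIdeal.mul_mem_right _ _ _ h
    · by_cases hf : f.1 = G.nextArrow g.1
      · have hfa : f.1 = G.nextArrow^[p.length + 1] a := by
          rw [Function.iterate_succ_apply', ← ha, hf]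
        refine .inr ⟨a, hfa, fun m hm => ?_⟩
        obtain hm | rfl := Nat.lt_succ_iff_lt_or_eq.1 hm
        · exact hmem m hm
        · exact (congrArg (· ∉ D) hfa).mp f.2.1
      · left
        rw [ofPath_cons, ofPath_cons, mul_assoc, ofPath_mul_ofPath]
        exact TwoSidedIdeal.mul_mem_left _ _ _ (G.ofPath_comp_mem_cutIdeal hf)

/-- A path outside the ideal is a walk avoiding `D`, hence shorter than a cycle, whose length is at
most the number of half-edges. The summand `2` is only there to make the exponent at least two, as
admissibility demands. -/
theorem arrowIdealPow_le_cutIdeal (hD : G.IsAdmissibleCut D) :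
    arrowIdealPow k (G.CutVertex D) (Nat.card (E × Bool) + 2) ≤ G.cutIdeal D k := by
  rw [arrowIdealPow, TwoSidedIdeal.span_le]
  rintro _ ⟨i, j, p, hp, rfl⟩
  cases p with
  | nil => simp at hp
  | cons p f =>
    rw [Quiver.Path.length_cons] at hp
    obtain h | ⟨a, -, hmem⟩ := G.ofPath_cons_mem_cutIdeal_or (k := k) p f
    · exact h
    · have h1 := hD.lt_period hmem
      have h2 := G.period_le_card a
      lia

theorem cutIdeal_le_arrowIdealPow : G.cutIdeal D k ≤ arrowIdealPow k (G.CutVertex D) 2 := by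
  rw [cutIdeal, TwoSidedIdeal.span_le]
  rintro _ ⟨i, j, l, f, g, -, rfl⟩
  exact TwoSidedIdeal.subset_span ⟨i, l, _, rfl, rfl⟩

omit [Fintype E] in
omit [Fintype E] in
-- An edge has only two half-edges. For `s4`, the arrows with zero product with `α` are those at the
-- relevant edge other than the one adjacent to `α` in its cycle, so at most one is left.
theorem eq_of_ne_of_ne {a b c : G.ArrowIndex} (hab : G.src a = G.src b) (hac : G.src a = G.src c)
    (hb : b ≠ a) (hc : c ≠ a) : b = c := by
  obtain ⟨⟨e, x⟩, ha⟩ := a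
  obtain ⟨⟨e', y⟩, hb'⟩ := b
  obtain ⟨⟨e'', z⟩, hc'⟩ := c
  obtain rfl : e = e' := hab
  obtain rfl : e = e'' := hac
  cases x <;> cases y <;> cases z <;> simp_all

theorem isGentleBoundQuiver_cutIdeal (hG : ¬ G.IsExceptional) (hD : G.IsAdmissibleCut D)
    (hmult : ∀ ν : V, G.mult ν = 1) : IsGentleBoundQuiver k (G.cutIdeal D k) where
  finite_arrows i j :=
    inferInstanceAs (Finite {a : G.ArrowIndex // a ∉ D ∧ G.toCut D (G.src a) = i ∧
      G.toCut D (G.tgt a) = j})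
  connected := by
    have : Nonempty E := by
      rw [IsExceptional, not_or, not_isEmpty_iff] at hG
      exact hG.1
    exact G.cutGraph_connected hD
  admissible := ⟨_, Nat.le_add_left 2 _, G.arrowIdealPow_le_cutIdeal hD,
    G.cutIdeal_le_arrowIdealPow⟩
  s1 := G.card_cutArrow_le
  s2 i j α := by
    have key : ∀ {i j l : G.CutVertex D} {f : i ⟶ j} {g : j ⟶ l},
        ofPath k (f.toPath.comp g.toPath) ∉ G.cutIdeal D k → g.1 = G.nextArrow f.1 := fun h => by
      by_contra hne
      exact h (G.ofPath_comp_mem_cutIdeal hne)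
    exact ⟨fun x hx y hy => G.cutSigma_ext_right ((key hx).trans (key hy).symm),
      fun x hx y hy => G.cutSigma_ext_left
        (G.nextArrow_injective ((key hx).symm.trans (key hy)))⟩
  s3 := by
    refine ⟨{p | ∃ (i j l : G.CutVertex D) (f : i ⟶ j) (g : j ⟶ l),
      g.1 ≠ G.nextArrow f.1 ∧ p = ⟨i, l, f.toPath.comp g.toPath⟩}, ?_, ?_⟩
    · rintro _ ⟨i, j, l, f, g, -, rfl⟩
      rfl
    · rw [cutIdeal]
      congr 1
      ext x
      constructor
      · rintro ⟨i, j, l, f, g, h, rfl⟩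
        exact ⟨_, ⟨i, j, l, f, g, h, rfl⟩, rfl⟩
      · rintro ⟨_, ⟨i, j, l, f, g, h, rfl⟩, rfl⟩
        exact ⟨i, j, l, f, g, h, rfl⟩
  s4 i j α := by
    refine ⟨fun x hx y hy => G.cutSigma_ext_right ?_, fun x hx y hy => G.cutSigma_ext_left ?_⟩
    · rw [Set.mem_ofPred_eq, G.ofPath_comp_mem_cutIdeal_iff hG hD hmult] at hx hy
      exact G.eq_of_ne_of_ne (α.2.2.2.trans x.2.2.2.1.symm) (α.2.2.2.trans y.2.2.2.1.symm) hx hy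
    · rw [Set.mem_ofPred_eq, G.ofPath_comp_mem_cutIdeal_iff hG hD hmult] at hx hy
      exact G.nextArrow_injective (G.eq_of_ne_of_ne (α.2.2.1.trans x.2.2.2.2.symm)
        (α.2.2.1.trans y.2.2.2.2.symm) hx.symm hy.symm)

end

end BrauerGraph

theorem corollary1p4 (k : Type v) [Field k] [IsAlgClosed k]
    {V : Type w} {E : Type u} [Finite V] [Fintype E]
    (G : BrauerGraph V E) (hG : ¬ G.IsExceptional) (hmult : ∀ ν : V, G.mult ν = 1) :
    ∃ (A : Type (max u v)) (_ : Ring A) (_ : Algebra k A),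
      IsGentle.{u} k A ∧
        Nonempty (BrauerGraphAlgebra k G ≃ₐ[k] TrivialExtension k A) := by
  obtain ⟨D, hD⟩ := G.exists_isAdmissibleCut
  choose σ hσ using G.exists_src_eq hG
  obtain ⟨hfin, he⟩ := G.finite_and_nonempty_algEquiv (k := k) hD hmult hσ
  exact ⟨BoundQuiverAlgebra k (G.cutIdeal D k), inferInstance, inferInstance,
    ⟨hfin, G.CutVertex D, inferInstance, inferInstance, G.cutIdeal D k,
      G.isGentleBoundQuiver_cutIdeal hG hD hmult, IsMoritaEquivalent.refl _ _⟩, he⟩
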